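/- For complex $p$ with $|p|<1$ and $z\neq 0$ let $\theta(z;p)=\prod_{j=0}^{\infty}(1-zp^j)(1-p^{j+1}/z)$, and for $n\ge 0$ let $(a;q,p)_n=\prod_{j=0}^{n-1}\theta(aq^j;p)$. A pair of complex sequences $(\alpha_n)_{n\ge0}$, $(\beta_n)_{n\ge0}$ is called an elliptic WP Bailey pair relative to $(a,k;q,p)$ if for all $n\ge 0$ $$\beta_n=\sum_{r=0}^n\frac{(k/a;q,p)_{n-r}}{(q;q,p)_{n-r}}\,\frac{(k;q,p)_{n+r}}{(aq;q,p)_{n+r}}\,\alpha_r .$$ **Theorem 5.1.** Let $a,k,q$ be nonzero complex numbers, let $|p|<1$, and put $m=a^2/k$. Assume that the parameters are generic in the sense that no denominator below vanishes, namely that for all integers $j\ge 0$ the numbers $\theta(q^{j+1};p)$, $\theta(aq^{j+1};p)$, $\theta(kq^{2j+1};p)$ and $\theta(mq^{2j};p)$ are nonzero. If $(\alpha_n(a,m;q,p))$, $(\beta_n(a,m;q,p))$ is an elliptic WP Bailey pair relative to $(a,m;q,p)$, then the sequences $$\alpha'_n(a,k;q,p)=\frac{(mq;q^2,p)_n}{(kq;q^2,p)_n}\Bigl(-\frac{a}{m}\Bigr)^n\alpha_n(a,m;q,p),$$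 $$\beta'_n(a,k;q,p)=\sum_{\substack{0\le r\le n\\ r\equiv n\ (\mathrm{mod}\ 2)}}\frac{\theta(mq^{2r};p)}{\theta(m;p)}\,\frac{(k/m;q^2,p)_{(n-r)/2}}{(q^2;q^2,p)_{(n-r)/2}}\,\frac{(k;q^2,p)_{(n+r)/2}}{(mq^2;q^2,p)_{(n+r)/2}}\Bigl(-\frac{a}{m}\Bigr)^r\beta_r(a,m;q,p)$$ form an elliptic WP Bailey pair relative to $(a,k;q,p)$. -/

import Mathlib

/-- The modified Jacobi theta function
`θ(z;p) = ∏_{j ≥ 0} (1 - z p^j) (1 - p^(j+1) / z)`, used for `z ≠ 0` and `‖p‖ < 1`. -/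
noncomputable def ellTheta (z p : ℂ) : ℂ :=
  ∏' j : ℕ, (1 - z * p ^ j) * (1 - p ^ (j + 1) / z)

/-- The elliptic `q`-shifted factorial `(a;q,p)_n = ∏_{j=0}^{n-1} θ(a q^j; p)`. -/
noncomputable def ellFactorial (a q p : ℂ) (n : ℕ) : ℂ :=
  ∏ j ∈ Finset.range n, ellTheta (a * q ^ j) p

/-- The sequences `α`, `β` form an elliptic WP Bailey pair relative to the parameters
`(a, k; q, p)`: for all `n`,
`β_n = ∑_{r=0}^n (k/a;q,p)_{n-r} (k;q,p)_{n+r} / ((q;q,p)_{n-r} (aq;q,p)_{n+r}) α_r`. -/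
def IsEllipticWPBaileyPair (a k q p : ℂ) (α β : ℕ → ℂ) : Prop :=
  ∀ n : ℕ, β n = ∑ r ∈ Finset.range (n + 1),
    (ellFactorial (k / a) q p (n - r) / ellFactorial q q p (n - r)) *
      (ellFactorial k q p (n + r) / ellFactorial (a * q) q p (n + r)) * α r

open Filter Topology

/-! ### The theta function as an infinite product -/

/-! Insert the defining sum of `β r` into the new sequence and interchange the sums. The coefficient
of `α s` is then a sum over `s ≤ r ≤ n`, `r ≡ n` mod 2, and it must equal the WP Bailey kernel for
`(a, k)` times the factor in the new `α`. With `r = s + j`, this sum is a prefactor times the same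
sum with `s = 0`, with `a`, `m`, `k` all multiplied by `q ^ (2 * s)` (`changeTerm_eq`). This scaling
preserves `k * m = a ^ 2`, so a single quadratic summation is needed (`sum_quadTerm`).

In that summation `j` has the parity of `n`. Splitting `(x;q)_{2i} = (x;q²)_i (xq;q²)_i` turns it
into a Frenkel–Turaev sum in base `q ^ 2`, whose balancing condition is exactly `k * m = a ^ 2`; the
two parities use different parameters.

The Frenkel–Turaev sum (`frenkelTuraev`) is proved by induction on `n`. The three-term theta
relation splits the very-well-poised factor into two products, each vanishing at one end of the
range. After an index shift the pieces recombine, by a second use of the relation, into the sum for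
`(a * q, k * q ^ 2)` and `n - 1`. This step divides by theta functions of `k`, and these extra
conditions are removed by continuity.

The three-term relation holds because `θ(xy) θ(x/y)` is, up to a factor, a 2 × 2 determinant in
functions of `x` and of `y`; it is then a Plücker relation. The determinant comes from multiplying
two Jacobi triple product series and splitting the double sum by parity. -/

theorem summable_norm_mul_pow {p : ℂ} (hp : ‖p‖ < 1) (z : ℂ) :
    Summable fun j : ℕ => ‖-(z * p ^ j)‖ := by
  simpa using (summable_geometric_of_lt_one (norm_nonneg p) hp).mul_left ‖z‖

theorem summable_norm_pow_succ_div {p : ℂ} (hp : ‖p‖ < 1) (z : ℂ) :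
    Summable fun j : ℕ => ‖-(p ^ (j + 1) / z)‖ := by
  convert summable_norm_mul_pow hp (p / z) using 3
  ring

theorem multipliable_one_sub_mul_pow {p : ℂ} (hp : ‖p‖ < 1) (z : ℂ) :
    Multipliable fun j : ℕ => 1 - z * p ^ j := by
  simpa [sub_eq_add_neg] using multipliable_one_add_of_summable (summable_norm_mul_pow hp z)

theorem multipliable_one_sub_pow_succ_div {p : ℂ} (hp : ‖p‖ < 1) (z : ℂ) :
    Multipliable fun j : ℕ => 1 - p ^ (j + 1) / z := by
  simpa [sub_eq_add_neg] using multipliable_one_add_of_summable (summable_norm_pow_succ_div hp z)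

theorem tendsto_prod_ellTheta {p : ℂ} (hp : ‖p‖ < 1) (z : ℂ) :
    Tendsto (fun N => ∏ j ∈ Finset.range N, (1 - z * p ^ j) * (1 - p ^ (j + 1) / z)) atTop
      (𝓝 (ellTheta z p)) :=
  ((multipliable_one_sub_mul_pow hp z).mul
    (multipliable_one_sub_pow_succ_div hp z)).hasProd.tendsto_prod_nat

theorem ellTheta_eq_mul_tprod {p : ℂ} (hp : ‖p‖ < 1) (z : ℂ) :
    ellTheta z p = (∏' j : ℕ, (1 - z * p ^ j)) * ∏' j : ℕ, (1 - p ^ (j + 1) / z) :=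
  (multipliable_one_sub_mul_pow hp z).tprod_mul (multipliable_one_sub_pow_succ_div hp z)

/-- An absolutely convergent product vanishes only if a factor does. This confines the zeros to a
countable set, as the density argument for the Frenkel–Turaev sum requires. -/
theorem exists_zpow_of_ellTheta_eq_zero {p z : ℂ} (hp : ‖p‖ < 1) (hz : z ≠ 0)
    (h : ellTheta z p = 0) : ∃ j : ℤ, z = p ^ j := by
  rw [ellTheta_eq_mul_tprod hp, mul_eq_zero] at h
  rcases h with h | h
  · have : ∃ j : ℕ, 1 - z * p ^ j = 0 := by
      by_contra! hne
      refine tprod_one_add_ne_zero_of_summable (f := fun j : ℕ => -(z * p ^ j)) (fun j => ?_)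
        (summable_norm_mul_pow hp z) (by simpa [sub_eq_add_neg] using h)
      simpa [sub_eq_add_neg] using hne j
    obtain ⟨j, hj⟩ := this
    refine ⟨-j, ?_⟩
    rw [zpow_neg, zpow_natCast]
    exact eq_inv_of_mul_eq_one_left (sub_eq_zero.mp hj).symm
  · have : ∃ j : ℕ, 1 - p ^ (j + 1) / z = 0 := by
      by_contra! hne
      refine tprod_one_add_ne_zero_of_summable (f := fun j : ℕ => -(p ^ (j + 1) / z)) (fun j => ?_)
        (summable_norm_pow_succ_div hp z) (by simpa [sub_eq_add_neg] using h)
      simpa [sub_eq_add_neg] using hne j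
    obtain ⟨j, hj⟩ := this
    refine ⟨(j + 1 : ℕ), ?_⟩
    rw [zpow_natCast]
    exact ((div_eq_one_iff_eq hz).mp (sub_eq_zero.mp hj).symm).symm

theorem ellTheta_one {p : ℂ} : ellTheta 1 p = 0 :=
  tprod_of_exists_eq_zero ⟨0, by simp⟩

theorem ellTheta_zero_right (z : ℂ) : ellTheta z 0 = 1 - z := by
  rw [ellTheta, tprod_eq_mulSingle 0]
  · simp
  · intro j hj
    simp [hj]

theorem continuousAt_ellTheta {p z : ℂ} (hp : ‖p‖ < 1) (hz : z ≠ 0) :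
    ContinuousAt (fun w => ellTheta w p) z := by
  -- Weierstrass M-test: a product dominated on an open set converges locally uniformly there, so
  -- its limit is continuous.
  have key : ∀ {f : ℕ → ℂ → ℂ} {u : ℕ → ℝ} {K : Set ℂ}, IsOpen K → z ∈ K → Summable u →
      (∀ n, ∀ x ∈ K, ‖f n x‖ ≤ u n) → (∀ n, ContinuousOn (f n) K) →
      ContinuousAt (fun x => ∏' n, (1 + f n x)) z := by
    intro f u K hK hzK hu hb hc
    have h := (hu.hasProdLocallyUniformlyOn_nat_one_add hK (Eventually.of_forall hb)
      hc).tendstoLocallyUniformlyOn_finsetRange.continuousOn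
      (Frequently.of_forall fun N => continuousOn_finsetProd _ fun n _ =>
        continuousOn_const.add (hc n))
    exact h.continuousAt (hK.mem_nhds hzK)
  have hgeo := summable_geometric_of_lt_one (norm_nonneg p) hp
  have h1 : ContinuousAt (fun w => ∏' j : ℕ, (1 - w * p ^ j)) z := by
    simp only [sub_eq_add_neg]
    refine key (u := fun j => (‖z‖ + 1) * ‖p‖ ^ j) (Metric.isOpen_ball (x := z) (ε := 1))
      (Metric.mem_ball_self one_pos) (hgeo.mul_left _) (fun n x hx => ?_) (fun n => by fun_prop)
    rw [norm_neg, norm_mul, norm_pow]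
    gcongr
    have := norm_sub_norm_le x z
    rw [Metric.mem_ball, dist_eq_norm] at hx
    linarith
  have h2 : ContinuousAt (fun w => ∏' j : ℕ, (1 - p ^ (j + 1) / w)) z := by
    simp only [sub_eq_add_neg]
    have hz' : 0 < ‖z‖ / 2 := by positivity
    -- Radius `‖z‖ / 2` keeps the ball away from the singularity at 0.
    refine key (u := fun j => 2 * ‖p‖ / ‖z‖ * ‖p‖ ^ j) (Metric.isOpen_ball (x := z) (ε := ‖z‖ / 2))
      (Metric.mem_ball_self hz') (hgeo.mul_left _) (fun n x hx => ?_) (fun n => ?_)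
    · rw [norm_neg, norm_div, norm_pow]
      have := norm_sub_norm_le z x
      rw [Metric.mem_ball, dist_comm, dist_eq_norm] at hx
      have hx' : ‖z‖ / 2 ≤ ‖x‖ := by linarith
      calc ‖p‖ ^ (n + 1) / ‖x‖ ≤ ‖p‖ ^ (n + 1) / (‖z‖ / 2) := by gcongr
        _ = 2 * ‖p‖ / ‖z‖ * ‖p‖ ^ n := by field_simp; ring
    · refine (continuousOn_const.div continuousOn_id fun x hx hx0 => ?_).neg
      simp only [id] at hx0
      rw [hx0, Metric.mem_ball, dist_comm, dist_zero_right] at hx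
      linarith
  rw [show (fun w => ellTheta w p) = _ from funext fun w => ellTheta_eq_mul_tprod hp w]
  exact h1.mul h2

/-! ### The Jacobi triple product -/

/-- The finite product `(p;p)_n = ∏_{j=1}^n (1 - p^j)`. -/
noncomputable def eulerProd (p : ℂ) (n : ℕ) : ℂ := ∏ j ∈ Finset.range n, (1 - p ^ (j + 1))

theorem one_sub_pow_succ_ne_zero {p : ℂ} (hp : ‖p‖ < 1) (j : ℕ) : 1 - p ^ (j + 1) ≠ 0 := by
  intro h
  have h1 : ‖p‖ ^ (j + 1) = 1 := by rw [← norm_pow, ← sub_eq_zero.mp h, norm_one]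
  exact (pow_lt_one₀ (norm_nonneg p) hp j.succ_ne_zero).ne h1

theorem eulerProd_ne_zero {p : ℂ} (hp : ‖p‖ < 1) (n : ℕ) : eulerProd p n ≠ 0 :=
  Finset.prod_ne_zero_iff.mpr fun j _ => one_sub_pow_succ_ne_zero hp j

theorem eulerProd_succ (p : ℂ) (n : ℕ) :
    eulerProd p (n + 1) = eulerProd p n * (1 - p ^ (n + 1)) := Finset.prod_range_succ _ _

theorem exists_tendsto_eulerProd {p : ℂ} (hp : ‖p‖ < 1) :
    ∃ E : ℂ, E ≠ 0 ∧ Tendsto (eulerProd p) atTop (𝓝 E) := by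
  have hs : Summable fun j : ℕ => ‖-(p ^ (j + 1))‖ := by
    simpa using summable_norm_pow_succ_div hp 1
  refine ⟨∏' j : ℕ, (1 + -(p ^ (j + 1))), tprod_one_add_ne_zero_of_summable (fun j => ?_) hs, ?_⟩
  · simpa [sub_eq_add_neg] using one_sub_pow_succ_ne_zero hp j
  · exact (multipliable_one_add_of_summable hs).hasProd.tendsto_prod_nat.congr fun n => by
      simp [eulerProd, sub_eq_add_neg]

/-- The reciprocal `1 / (p;p)_n`, extended by zero to negative integers `n`. -/
noncomputable def eulerInv (p : ℂ) (n : ℤ) : ℂ := if n < 0 then 0 else (eulerProd p n.toNat)⁻¹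

theorem eulerInv_natCast (p : ℂ) (n : ℕ) : eulerInv p n = (eulerProd p n)⁻¹ := by
  simp [eulerInv]

/-- Extension by zero makes the recurrence valid on all of `ℤ`: at `n = 0` the factor `1 - p ^ 0`
vanishes. Hence the finite triple product needs no boundary cases. -/
theorem eulerInv_sub_one {p : ℂ} (hp : ‖p‖ < 1) (n : ℤ) :
    eulerInv p (n - 1) = (1 - p ^ n) * eulerInv p n := by
  rcases lt_trichotomy n 0 with h | rfl | h
  · simp [eulerInv, h, show n - 1 < 0 by omega]
  · simp [eulerInv]
  · obtain ⟨m, rfl⟩ : ∃ m : ℕ, n = (m + 1 : ℕ) := ⟨(n - 1).toNat, by omega⟩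
    have h1 := eulerProd_ne_zero hp m
    have h2 := one_sub_pow_succ_ne_zero hp m
    rw [show ((m + 1 : ℕ) : ℤ) - 1 = (m : ℕ) by push_cast; ring, eulerInv_natCast,
      eulerInv_natCast, eulerProd_succ, zpow_natCast]
    field_simp

theorem exists_norm_eulerInv_le {p : ℂ} (hp : ‖p‖ < 1) : ∃ C : ℝ, ∀ n, ‖eulerInv p n‖ ≤ C := by
  obtain ⟨E, hE, hlim⟩ := exists_tendsto_eulerProd hp
  obtain ⟨C, hC⟩ := (hlim.inv₀ hE).norm.bddAbove_range
  refine ⟨max C 0, fun n => ?_⟩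
  rw [eulerInv]
  split_ifs
  · simp
  · exact le_max_of_le_left (hC ⟨n.toNat, rfl⟩)

/-- The coefficients of the finite form of the triple product, in base `p = u ^ 2`. -/
noncomputable def tripleCoeff (u : ℂ) (N : ℕ) (n : ℤ) : ℂ :=
  eulerProd (u ^ 2) (2 * N) * ((-1) ^ n * u ^ (n ^ 2 - n)) *
    (eulerInv (u ^ 2) (N + n) * eulerInv (u ^ 2) (N - n))

theorem norm_sq_lt_one {u : ℂ} (hu : ‖u‖ < 1) : ‖u ^ 2‖ < 1 := by
  rw [norm_pow]
  exact pow_lt_one₀ (norm_nonneg u) hu two_ne_zero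

/-- This is multiplication of a Laurent polynomial by `(1 - z p^N)(1 - p^(N+1)/z)`, read off on
coefficients, with `p = u ^ 2`. All reciprocals reduce to those at `N + 1 + n` and `N + 1 - n`,
leaving a rational identity. -/
theorem tripleCoeff_succ {u : ℂ} (hu0 : u ≠ 0) (hu : ‖u‖ < 1) (N : ℕ) (n : ℤ) :
    tripleCoeff u (N + 1) n = (1 + (u ^ 2) ^ (2 * N + 1)) * tripleCoeff u N n
      - (u ^ 2) ^ N * tripleCoeff u N (n - 1) - (u ^ 2) ^ (N + 1) * tripleCoeff u N (n + 1) := by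
  have hp := norm_sq_lt_one hu
  have hp0 : u ^ 2 ≠ 0 := pow_ne_zero 2 hu0
  have key := eulerInv_sub_one hp
  have x1 : eulerInv (u ^ 2) (N + n) = (1 - (u ^ 2) ^ ((N : ℤ) + 1 + n)) *
      eulerInv (u ^ 2) (N + 1 + n) := by
    rw [← key]; congr 1; ring
  have x2 : eulerInv (u ^ 2) (N + (n - 1)) = (1 - (u ^ 2) ^ ((N : ℤ) + n)) *
      eulerInv (u ^ 2) (N + n) := by
    rw [← key]; congr 1; ring
  have y1 : eulerInv (u ^ 2) (N - n) = (1 - (u ^ 2) ^ ((N : ℤ) + 1 - n)) *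
      eulerInv (u ^ 2) (N + 1 - n) := by
    rw [← key]; congr 1; ring
  have y2 : eulerInv (u ^ 2) (N - (n + 1)) = (1 - (u ^ 2) ^ ((N : ℤ) - n)) *
      eulerInv (u ^ 2) (N - n) := by
    rw [← key]; congr 1; ring
  have x3 : eulerInv (u ^ 2) (N + (n + 1)) = eulerInv (u ^ 2) (N + 1 + n) := by
    congr 1; ring
  have y3 : eulerInv (u ^ 2) (N - (n - 1)) = eulerInv (u ^ 2) (N + 1 - n) := by
    congr 1; ring
  have u1 : u ^ ((n - 1) ^ 2 - (n - 1)) = u ^ (n ^ 2 - n) * (u ^ 2 / (u ^ 2) ^ n) := by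
    rw [show (n - 1) ^ 2 - (n - 1) = (n ^ 2 - n) + 2 - 2 * n by ring, zpow_sub₀ hu0,
      zpow_add₀ hu0, zpow_mul]
    norm_cast
    ring
  have u2 : u ^ ((n + 1) ^ 2 - (n + 1)) = u ^ (n ^ 2 - n) * (u ^ 2) ^ n := by
    rw [show (n + 1) ^ 2 - (n + 1) = (n ^ 2 - n) + 2 * n by ring, zpow_add₀ hu0, zpow_mul]
    norm_cast
  have s1 : (-1 : ℂ) ^ (n - 1) = -(-1) ^ n := by
    rw [zpow_sub₀ (by norm_num)]; simp [div_neg]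
  have s2 : (-1 : ℂ) ^ (n + 1) = -(-1) ^ n := by
    rw [zpow_add₀ (by norm_num)]; simp
  simp only [tripleCoeff]
  rw [show 2 * (N + 1) = 2 * N + 1 + 1 by ring, eulerProd_succ, eulerProd_succ, x2, x1, y2, y1,
    x3, y3, u1, u2, s1, s2]
  simp only [Nat.cast_add, Nat.cast_one]
  have hw : (u ^ 2) ^ n ≠ 0 := zpow_ne_zero n hp0
  rw [zpow_sub₀ hp0, zpow_sub₀ hp0, zpow_add₀ hp0 _ n, zpow_add₀ hp0 _ n, zpow_add₀ hp0, zpow_natCast, zpow_one]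
  generalize (u ^ 2) ^ n = w at *
  generalize u ^ (n ^ 2 - n) = c
  generalize eulerInv (u ^ 2) (N + 1 + n) = x
  generalize eulerInv (u ^ 2) (N + 1 - n) = y
  generalize eulerProd (u ^ 2) (2 * N) = e
  generalize (-1 : ℂ) ^ n = s
  rw [show 2 * N + 1 + 1 = N + N + 2 by ring, show 2 * N + 1 = N + N + 1 by ring]
  simp only [pow_add]
  generalize (u ^ 2) ^ N = P
  field_simp
  ring

theorem hasSum_tripleCoeff {u z : ℂ} (hu0 : u ≠ 0) (hu : ‖u‖ < 1) (hz : z ≠ 0) (N : ℕ) :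
    HasSum (fun n : ℤ => tripleCoeff u N n * z ^ n)
      (∏ j ∈ Finset.range N, (1 - z * (u ^ 2) ^ j) * (1 - (u ^ 2) ^ (j + 1) / z)) := by
  induction N with
  | zero =>
    rw [Finset.prod_range_zero]
    refine (hasSum_ite_eq (0 : ℤ) (1 : ℂ)).congr_fun fun n => ?_
    split_ifs with h
    · subst h; simp [tripleCoeff, eulerInv, eulerProd]
    · rcases lt_or_gt_of_ne h with h | h
      · simp [tripleCoeff, eulerInv, h]
      · simp [tripleCoeff, eulerInv, h]
  | succ N ih =>
    have h1 := (Equiv.subRight (1 : ℤ)).hasSum_iff.mpr ih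
    have h2 := (Equiv.addRight (1 : ℤ)).hasSum_iff.mpr ih
    have h3 := ((ih.mul_left (1 + (u ^ 2) ^ (2 * N + 1))).sub
      (h1.mul_left (z * (u ^ 2) ^ N))).sub (h2.mul_left ((u ^ 2) ^ (N + 1) / z))
    have hprod : (1 - z * (u ^ 2) ^ N) * (1 - (u ^ 2) ^ (N + 1) / z) =
        1 + (u ^ 2) ^ (2 * N + 1) - z * (u ^ 2) ^ N - (u ^ 2) ^ (N + 1) / z := by
      rw [show 2 * N + 1 = N + (N + 1) by ring, pow_add]
      field_simp
      ring
    rw [Finset.prod_range_succ, mul_comm, hprod, sub_mul, sub_mul]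
    refine h3.congr_fun fun n => ?_
    simp only [Function.comp, Equiv.subRight_apply, Equiv.coe_addRight]
    rw [tripleCoeff_succ hu0 hu, zpow_sub₀ hz, zpow_add₀ hz, zpow_one]
    field_simp

/-- The terms are those of the two-variable Jacobi theta series with `τ = log u / (πi)`, whose
imaginary part is positive because `‖u‖ < 1`. -/
theorem summable_norm_zpow_sq {u w : ℂ} (hu0 : u ≠ 0) (hu : ‖u‖ < 1) (hw : w ≠ 0) :
    Summable fun n : ℤ => ‖u ^ (n ^ 2) * w ^ n‖ := by
  have hpi : (Real.pi : ℂ) ≠ 0 := by exact_mod_cast Real.pi_ne_zero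
  have h := (summable_jacobiTheta₂_term_iff (Complex.log w / (2 * Real.pi * Complex.I))
    (Complex.log u / (Real.pi * Complex.I))).mpr (by
      have : Complex.log u / (Real.pi * Complex.I) = -(Complex.log u / Real.pi * Complex.I) := by
        field_simp
        rw [Complex.I_sq]; ring
      rw [this, Complex.neg_im, Complex.mul_I_im, Complex.div_ofReal_re,
        Complex.log_re]
      exact neg_pos.mpr (div_neg_of_neg_of_pos (Real.log_neg (norm_pos_iff.mpr hu0) hu)
        Real.pi_pos)) |>.norm
  refine h.congr fun n => ?_
  congr 1
  rw [jacobiTheta₂_term]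
  have : 2 * Real.pi * Complex.I * n * (Complex.log w / (2 * Real.pi * Complex.I)) +
      Real.pi * Complex.I * n ^ 2 * (Complex.log u / (Real.pi * Complex.I)) =
      ((n ^ 2 : ℤ) : ℂ) * Complex.log u + (n : ℂ) * Complex.log w := by
    push_cast
    field_simp
    ring
  rw [this, Complex.exp_add, Complex.exp_int_mul, Complex.exp_int_mul, Complex.exp_log hu0,
    Complex.exp_log hw]

theorem summable_norm_zpow_sq_sub {u z : ℂ} (hu0 : u ≠ 0) (hu : ‖u‖ < 1) (hz : z ≠ 0) :
    Summable fun n : ℤ => ‖(-1) ^ n * u ^ (n ^ 2 - n) * z ^ n‖ := by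
  refine (summable_norm_zpow_sq hu0 hu (w := -z / u) (by simp [hu0, hz])).congr fun n => ?_
  rw [zpow_sub₀ hu0, div_zpow, neg_eq_neg_one_mul, mul_zpow]
  congr 1
  field_simp

theorem tendsto_eulerInv {p : ℂ} {E : ℂ} (hE : E ≠ 0) (h : Tendsto (eulerProd p) atTop (𝓝 E))
    {f : ℕ → ℤ} (hf : Tendsto f atTop atTop) :
    Tendsto (fun N => eulerInv p (f N)) atTop (𝓝 E⁻¹) := by
  have h1 : Tendsto (fun N => (f N).toNat) atTop atTop := by
    refine tendsto_atTop.mpr fun b => ?_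
    filter_upwards [hf.eventually_ge_atTop (b : ℤ)] with N hN
    omega
  refine ((h.inv₀ hE).comp h1).congr' ?_
  filter_upwards [hf.eventually_ge_atTop 0] with N hN
  simp [eulerInv, not_lt.mpr hN]

/-- The Jacobi triple product identity, with the constant `1 / (p;p)_∞` left implicit. -/
theorem exists_ellTheta_eq_tsum {u : ℂ} (hu0 : u ≠ 0) (hu : ‖u‖ < 1) :
    ∃ C : ℂ, ∀ z : ℂ, z ≠ 0 →
      ellTheta z (u ^ 2) = C * ∑' n : ℤ, (-1) ^ n * u ^ (n ^ 2 - n) * z ^ n := by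
  have hp := norm_sq_lt_one hu
  obtain ⟨E, hE, hlim⟩ := exists_tendsto_eulerProd hp
  obtain ⟨C₁, hC₁⟩ := exists_norm_eulerInv_le hp
  obtain ⟨C₂, hC₂⟩ := hlim.norm.bddAbove_range
  have hC₂' : ∀ n, ‖eulerProd (u ^ 2) n‖ ≤ C₂ := fun n => hC₂ ⟨n, rfl⟩
  have hC₁0 : 0 ≤ C₁ := (norm_nonneg _).trans (hC₁ 0)
  refine ⟨E⁻¹, fun z hz => ?_⟩
  refine tendsto_nhds_unique (tendsto_prod_ellTheta hp z) ?_
  rw [← tsum_mul_left]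
  have h2 : Tendsto (fun N : ℕ => 2 * N) atTop atTop :=
    tendsto_id.const_mul_atTop' (by norm_num)
  -- Let `N → ∞` in the finite triple product: the Euler products and their reciprocals are
  -- uniformly bounded, so the limiting series dominates up to a constant.
  refine (tendsto_tsum_of_dominated_convergence
    (f := fun N n => tripleCoeff u N n * z ^ n)
    (bound := fun n : ℤ => C₂ * (C₁ * C₁) * ‖(-1) ^ n * u ^ (n ^ 2 - n) * z ^ n‖)
    ((summable_norm_zpow_sq_sub hu0 hu hz).mul_left _) (fun n => ?_)
    (Eventually.of_forall fun N n => ?_)).congr fun N => (hasSum_tripleCoeff hu0 hu hz N).tsum_eq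
  · have hadd : Tendsto (fun N : ℕ => (N : ℤ) + n) atTop atTop :=
      tendsto_atTop_add_const_right _ _ tendsto_natCast_atTop_atTop
    have hsub : Tendsto (fun N : ℕ => (N : ℤ) - n) atTop atTop :=
      tendsto_atTop_add_const_right _ _ tendsto_natCast_atTop_atTop
    have := (((hlim.comp h2).mul_const ((-1) ^ n * u ^ (n ^ 2 - n))).mul
      ((tendsto_eulerInv hE hlim hadd).mul (tendsto_eulerInv hE hlim hsub))).mul_const (z ^ n)
    rwa [show E * ((-1) ^ n * u ^ (n ^ 2 - n)) * (E⁻¹ * E⁻¹) * z ^ n =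
      E⁻¹ * ((-1) ^ n * u ^ (n ^ 2 - n) * z ^ n) by field_simp] at this
  · have : tripleCoeff u N n * z ^ n = eulerProd (u ^ 2) (2 * N) *
        (eulerInv (u ^ 2) (N + n) * eulerInv (u ^ 2) (N - n)) *
        ((-1) ^ n * u ^ (n ^ 2 - n) * z ^ n) := by rw [tripleCoeff]; ring
    rw [this, norm_mul, norm_mul (eulerProd _ _), norm_mul (eulerInv _ _)]
    gcongr
    · exact (norm_nonneg _).trans (hC₂' 0)
    · exact hC₂' _
    · exact hC₁ _
    · exact hC₁ _

/-! ### Inversion and the addition formula -/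

theorem exists_sq_eq_complex (p : ℂ) : ∃ u : ℂ, u ^ 2 = p := by
  exact IsAlgClosed.exists_pow_nat_eq p two_pos

theorem norm_lt_one_of_sq {u : ℂ} (h : ‖u ^ 2‖ < 1) : ‖u‖ < 1 := by
  rw [norm_pow] at h
  exact (pow_lt_one_iff_of_nonneg (norm_nonneg u) two_ne_zero).mp h

/-- The reflection `n ↦ 1 - n` fixes the exponent `n ^ 2 - n` and changes the sign `(-1) ^ n`. -/
theorem ellTheta_inv {p z : ℂ} (hp : ‖p‖ < 1) (hz : z ≠ 0) :
    ellTheta z⁻¹ p = -ellTheta z p / z := by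
  obtain ⟨u, rfl⟩ := exists_sq_eq_complex p
  rcases eq_or_ne u 0 with rfl | hu0
  · simp only [ne_eq, OfNat.ofNat_ne_zero, not_false_eq_true, zero_pow, ellTheta_zero_right]
    field_simp
    ring
  obtain ⟨C, hC⟩ := exists_ellTheta_eq_tsum hu0 (norm_lt_one_of_sq hp)
  rw [hC _ hz, hC _ (inv_ne_zero hz), ← (Equiv.subLeft (1 : ℤ)).tsum_eq, neg_div, mul_div_assoc,
    ← tsum_div_const, ← mul_neg, ← tsum_neg]
  congr 2 with n
  have h1 : (-1 : ℂ) ^ (1 - n) = -(-1) ^ n := by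
    rw [zpow_sub₀ (by norm_num), zpow_one, div_eq_mul_inv, ← inv_zpow]
    norm_num
  have h2 : z⁻¹ ^ (1 - n) = z ^ n / z := by
    rw [inv_zpow', neg_sub, zpow_sub₀ hz, zpow_one]
  rw [Equiv.subLeft_apply, show (1 - n) ^ 2 - (1 - n) = n ^ 2 - n by ring, h1, h2]
  ring

/-- Splitting of `ℤ × ℤ` according to the parity of the sum of the coordinates, written in the
half-sum and the half-difference. -/
def intProdParityEquiv : (ℤ × ℤ) ⊕ (ℤ × ℤ) ≃ ℤ × ℤ where
  toFun := Sum.elim (fun x => (x.1 + x.2, x.1 - x.2)) (fun x => (x.1 + x.2 + 1, x.1 - x.2))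
  invFun y := if (y.1 + y.2) % 2 = 0 then Sum.inl ((y.1 + y.2) / 2, (y.1 - y.2) / 2)
    else Sum.inr ((y.1 + y.2) / 2, (y.1 - y.2) / 2)
  left_inv := by
    rintro (⟨s, d⟩ | ⟨s, d⟩)
    · have h1 : (s + d + (s - d)) % 2 = 0 := by omega
      have h2 : (s + d + (s - d)) / 2 = s := by omega
      have h3 : (s + d - (s - d)) / 2 = d := by omega
      simp only [Sum.elim_inl, h1, h2, h3, if_true]
    · have h1 : ¬ (s + d + 1 + (s - d)) % 2 = 0 := by omega
      have h2 : (s + d + 1 + (s - d)) / 2 = s := by omega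
      have h3 : (s + d + 1 - (s - d)) / 2 = d := by omega
      simp only [Sum.elim_inr, h1, h2, h3, if_false]
  right_inv := by
    rintro ⟨a, b⟩
    dsimp only
    split_ifs with h
    · simp only [Sum.elim_inl, Prod.mk.injEq]
      omega
    · simp only [Sum.elim_inr, Prod.mk.injEq]
      omega

theorem HasSum.of_parity {f : ℤ × ℤ → ℂ} {a b : ℂ}
    (h1 : HasSum (fun w : ℤ × ℤ => f (w.1 + w.2, w.1 - w.2)) a)
    (h2 : HasSum (fun w : ℤ × ℤ => f (w.1 + w.2 + 1, w.1 - w.2)) b) : HasSum f (a + b) :=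
  intProdParityEquiv.hasSum_iff.mp (HasSum.sum h1 h2)

theorem HasSum.mul_of_summable_norm {f g : ℤ → ℂ} {a b : ℂ} (hf : HasSum f a) (hg : HasSum g b)
    (hf' : Summable fun n => ‖f n‖) (hg' : Summable fun n => ‖g n‖) :
    HasSum (fun w : ℤ × ℤ => f w.1 * g w.2) (a * b) :=
  hf.mul hg (summable_mul_of_summable_norm hf' hg')

theorem neg_one_zpow_add_mul_sub (s d : ℤ) : (-1 : ℂ) ^ (s + d) * (-1) ^ (s - d) = 1 := by
  rw [← zpow_add₀ (by norm_num)]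
  exact Even.neg_one_zpow ⟨s, by ring⟩

theorem mul_zpow_mul_div_zpow {x y : ℂ} (hx : x ≠ 0) (hy : y ≠ 0) (s d : ℤ) :
    (x * y) ^ (s + d) * (x / y) ^ (s - d) = (x ^ 2) ^ s * (y ^ 2) ^ d := by
  have h : ∀ a b : ℂ, a ≠ 0 → b ≠ 0 → a ^ (s + d) * b ^ (s - d) = (a * b) ^ s * (a / b) ^ d := by
    intro a b ha hb
    rw [zpow_add₀ ha, zpow_sub₀ hb, mul_zpow, div_zpow]
    ring
  rw [h _ _ (mul_ne_zero hx hy) (div_ne_zero hx hy)]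
  congr 2 <;> field_simp

/-- In the half-sum `s` and half-difference `d` the quadratic exponent has no cross term, so `x` and
`y` separate. -/
theorem theta_term_mul_even {u x y : ℂ} (hu : u ≠ 0) (hx : x ≠ 0) (hy : y ≠ 0) (s d : ℤ) :
    (-1) ^ (s + d) * u ^ ((s + d) ^ 2 - (s + d)) * (x * y) ^ (s + d) *
      ((-1) ^ (s - d) * u ^ ((s - d) ^ 2 - (s - d)) * (x / y) ^ (s - d)) =
    (u ^ 2) ^ (s ^ 2) * (x ^ 2 / u ^ 2) ^ s * ((u ^ 2) ^ (d ^ 2) * (y ^ 2) ^ d) := by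
  have hp0 : u ^ 2 ≠ 0 := pow_ne_zero 2 hu
  have e1 : u ^ ((s + d) ^ 2 - (s + d)) * u ^ ((s - d) ^ 2 - (s - d)) =
      (u ^ 2) ^ (s ^ 2) * (u ^ 2) ^ (d ^ 2) / (u ^ 2) ^ s := by
    rw [← zpow_add₀ hu, ← zpow_add₀ hp0, ← zpow_sub₀ hp0, ← zpow_natCast, ← zpow_mul]
    congr 1; push_cast; ring
  calc _ = ((-1 : ℂ) ^ (s + d) * (-1) ^ (s - d)) *
        (u ^ ((s + d) ^ 2 - (s + d)) * u ^ ((s - d) ^ 2 - (s - d))) *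
        ((x * y) ^ (s + d) * (x / y) ^ (s - d)) := by ring
    _ = _ := by
      rw [neg_one_zpow_add_mul_sub, e1, mul_zpow_mul_div_zpow hx hy, div_zpow]
      ring

theorem theta_term_mul_odd {u x y : ℂ} (hu : u ≠ 0) (hx : x ≠ 0) (hy : y ≠ 0) (s d : ℤ) :
    (-1) ^ (s + d + 1) * u ^ ((s + d + 1) ^ 2 - (s + d + 1)) * (x * y) ^ (s + d + 1) *
      ((-1) ^ (s - d) * u ^ ((s - d) ^ 2 - (s - d)) * (x / y) ^ (s - d)) =
    -x * ((u ^ 2) ^ (s ^ 2) * (x ^ 2) ^ s * ((u ^ 2) ^ (d ^ 2) * (u ^ 2 * y ^ 2) ^ d * y)) := by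
  have hp0 : u ^ 2 ≠ 0 := pow_ne_zero 2 hu
  have e1 : u ^ ((s + d + 1) ^ 2 - (s + d + 1)) * u ^ ((s - d) ^ 2 - (s - d)) =
      (u ^ 2) ^ (s ^ 2) * (u ^ 2) ^ (d ^ 2) * (u ^ 2) ^ d := by
    rw [← zpow_add₀ hu, ← zpow_add₀ hp0, ← zpow_add₀ hp0, ← zpow_natCast, ← zpow_mul]
    congr 1; push_cast; ring
  calc _ = ((-1 : ℂ) ^ (s + d) * (-1) ^ (s - d)) * (-1) *
        (u ^ ((s + d + 1) ^ 2 - (s + d + 1)) * u ^ ((s - d) ^ 2 - (s - d))) *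
        ((x * y) ^ (s + d) * (x / y) ^ (s - d)) * (x * y) := by
          rw [zpow_add₀ (by norm_num) _ 1, zpow_add₀ (mul_ne_zero hx hy) _ 1, zpow_one, zpow_one]
          ring
    _ = _ := by
      rw [neg_one_zpow_add_mul_sub, e1, mul_zpow_mul_div_zpow hx hy, mul_zpow]
      ring

/-- The theta series `∑ p^(d^2) x^(2d)`. -/
noncomputable def evenTheta (p x : ℂ) : ℂ := ∑' d : ℤ, p ^ (d ^ 2) * (x ^ 2) ^ d

/-- The theta series `∑ p^(d^2+d) x^(2d+1)`. -/
noncomputable def oddTheta (p x : ℂ) : ℂ := ∑' d : ℤ, p ^ (d ^ 2) * (p * x ^ 2) ^ d * x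

theorem summable_norm_evenTheta {p x : ℂ} (hp0 : p ≠ 0) (hp : ‖p‖ < 1) (hx : x ≠ 0) :
    Summable fun d : ℤ => ‖p ^ (d ^ 2) * (x ^ 2) ^ d‖ :=
  summable_norm_zpow_sq hp0 hp (pow_ne_zero 2 hx)

theorem summable_norm_oddTheta {p x : ℂ} (hp0 : p ≠ 0) (hp : ‖p‖ < 1) (hx : x ≠ 0) :
    Summable fun d : ℤ => ‖p ^ (d ^ 2) * (p * x ^ 2) ^ d * x‖ := by
  simpa only [norm_mul _ x] using
    (summable_norm_zpow_sq hp0 hp (mul_ne_zero hp0 (pow_ne_zero 2 hx))).mul_right ‖x‖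

theorem hasSum_evenTheta {p x : ℂ} (hp0 : p ≠ 0) (hp : ‖p‖ < 1) (hx : x ≠ 0) :
    HasSum (fun d : ℤ => p ^ (d ^ 2) * (x ^ 2) ^ d) (evenTheta p x) :=
  (summable_norm_evenTheta hp0 hp hx).of_norm.hasSum

theorem hasSum_oddTheta {p x : ℂ} (hp0 : p ≠ 0) (hp : ‖p‖ < 1) (hx : x ≠ 0) :
    HasSum (fun d : ℤ => p ^ (d ^ 2) * (p * x ^ 2) ^ d * x) (oddTheta p x) :=
  (summable_norm_oddTheta hp0 hp hx).of_norm.hasSum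

theorem hasSum_mul_oddTheta {p x : ℂ} (hp0 : p ≠ 0) (hp : ‖p‖ < 1) (hx : x ≠ 0) :
    HasSum (fun d : ℤ => p ^ (d ^ 2) * (x ^ 2 / p) ^ d) (x * oddTheta p x) := by
  have := (Equiv.subRight (1 : ℤ)).hasSum_iff.mpr
    ((hasSum_oddTheta hp0 hp hx).mul_left x)
  refine this.congr_fun fun d => ?_
  simp only [Function.comp, Equiv.subRight_apply]
  have h1 : p ^ ((d - 1) ^ 2) = p ^ (d ^ 2) * p / (p ^ d * p ^ d) := by
    rw [show (d - 1) ^ 2 = d ^ 2 + 1 - (d + d) by ring, zpow_sub₀ hp0, zpow_add₀ hp0,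
      zpow_add₀ hp0, zpow_one]
  have h2 : (p * x ^ 2) ^ (d - 1) = p ^ d * (x ^ 2) ^ d / (p * x ^ 2) := by
    rw [zpow_sub₀ (mul_ne_zero hp0 (pow_ne_zero 2 hx)), mul_zpow, zpow_one]
  have h3 : p ^ d ≠ 0 := zpow_ne_zero d hp0
  rw [h1, h2, div_zpow]
  generalize p ^ d = P at *
  generalize p ^ (d ^ 2) = R
  generalize (x ^ 2) ^ d = X
  field_simp

theorem hasSum_theta_mul {u x y : ℂ} (hu0 : u ≠ 0) (hu : ‖u‖ < 1) (hx : x ≠ 0) (hy : y ≠ 0) :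
    HasSum (fun w : ℤ × ℤ => (-1) ^ w.1 * u ^ (w.1 ^ 2 - w.1) * (x * y) ^ w.1 *
      ((-1) ^ w.2 * u ^ (w.2 ^ 2 - w.2) * (x / y) ^ w.2))
      (x * (oddTheta (u ^ 2) x * evenTheta (u ^ 2) y -
        evenTheta (u ^ 2) x * oddTheta (u ^ 2) y)) := by
  have hp := norm_sq_lt_one hu
  have hp0 : u ^ 2 ≠ 0 := pow_ne_zero 2 hu0
  have hG := hasSum_mul_oddTheta hp0 hp hx
  have h1 := hG.mul_of_summable_norm (hasSum_evenTheta hp0 hp hy) hG.summable.norm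
    (summable_norm_evenTheta hp0 hp hy)
  have h2 := ((hasSum_evenTheta hp0 hp hx).mul_of_summable_norm (hasSum_oddTheta hp0 hp hy)
    (summable_norm_evenTheta hp0 hp hx) (summable_norm_oddTheta hp0 hp hy)).mul_left (-x)
  have h4 : x * (oddTheta (u ^ 2) x * evenTheta (u ^ 2) y -
      evenTheta (u ^ 2) x * oddTheta (u ^ 2) y) = x * oddTheta (u ^ 2) x * evenTheta (u ^ 2) y +
      -x * (evenTheta (u ^ 2) x * oddTheta (u ^ 2) y) := by ring
  rw [h4]
  refine HasSum.of_parity ?_ ?_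
  · exact h1.congr_fun fun w => theta_term_mul_even hu0 hx hy w.1 w.2
  · exact h2.congr_fun fun w => theta_term_mul_odd hu0 hx hy w.1 w.2

/-- The product `θ(xy) θ(x/y)` is a `2 × 2` determinant of functions of one variable. -/
theorem exists_ellTheta_mul_eq_det {p : ℂ} (hp : ‖p‖ < 1) :
    ∃ (C : ℂ) (F G : ℂ → ℂ), ∀ x y : ℂ, x ≠ 0 → y ≠ 0 →
      ellTheta (x * y) p * ellTheta (x / y) p = C * x * (G x * F y - F x * G y) := by
  obtain ⟨u, rfl⟩ := exists_sq_eq_complex p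
  rcases eq_or_ne u 0 with rfl | hu0
  -- At `p = 0` this is `(1 - xy)(1 - x/y) = x((x + 1/x) - (y + 1/y))`.
  · refine ⟨1, fun _ => 1, fun x => (1 + x ^ 2) / x, fun x y hx hy => ?_⟩
    simp only [ne_eq, OfNat.ofNat_ne_zero, not_false_eq_true, zero_pow, ellTheta_zero_right]
    field_simp
    ring
  have hu := norm_lt_one_of_sq hp
  obtain ⟨C, hC⟩ := exists_ellTheta_eq_tsum hu0 hu
  refine ⟨C ^ 2, evenTheta (u ^ 2), oddTheta (u ^ 2), fun x y hx hy => ?_⟩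
  have hS : ∀ z : ℂ, z ≠ 0 → Summable fun n : ℤ => ‖(-1) ^ n * u ^ (n ^ 2 - n) * z ^ n‖ :=
    fun z hz => summable_norm_zpow_sq_sub hu0 hu hz
  have hxy := mul_ne_zero hx hy
  have hxy' := div_ne_zero hx hy
  rw [hC _ hxy, hC _ hxy', mul_mul_mul_comm, tsum_mul_tsum_of_summable_norm (hS _ hxy) (hS _ hxy'),
    (hasSum_theta_mul hu0 hu hx hy).tsum_eq]
  ring

/-- The three-term relation for theta functions. -/
theorem ellTheta_addition {p : ℂ} (hp : ‖p‖ < 1) {x y u v : ℂ} (hx : x ≠ 0) (hy : y ≠ 0)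
    (hu : u ≠ 0) (hv : v ≠ 0) :
    ellTheta (x * y) p * ellTheta (x / y) p * (ellTheta (u * v) p * ellTheta (u / v) p) -
      ellTheta (x * v) p * ellTheta (x / v) p * (ellTheta (u * y) p * ellTheta (u / y) p) =
      u / y * (ellTheta (y * v) p * ellTheta (y / v) p *
        (ellTheta (x * u) p * ellTheta (x / u) p)) := by
  obtain ⟨C, F, G, h⟩ := exists_ellTheta_mul_eq_det hp
  -- What remains is the Plücker relation among the 2 × 2 minors of four vectors `(F, G)`.
  rw [h x y hx hy, h u v hu hv, h x v hx hv, h u y hu hy, h y v hy hv, h x u hx hu]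
  field_simp
  ring

/-- The three-term relation in the form used for well-poised series. A square root `w` of `c₁ * c₂`
recovers the symmetric variables `x = z w`, `y = c₁ / w`, `u = z A / w`, `v = c₃ w / A`. -/
theorem ellTheta_addition_balanced {p : ℂ} (hp : ‖p‖ < 1) {z A c₁ c₂ c₃ c₄ : ℂ} (hz : z ≠ 0)
    (hA : A ≠ 0) (hc : c₁ * c₂ * c₃ * c₄ = A ^ 2) :
    ellTheta (c₁ * z) p * ellTheta (c₂ * z) p * ellTheta (c₃ * z) p * ellTheta (c₄ * z) p -
      ellTheta (A * z / c₁) p * ellTheta (A * z / c₂) p * ellTheta (A * z / c₃) p *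
        ellTheta (A * z / c₄) p =
      A * z / c₁ * (ellTheta (c₁ * c₃ / A) p * ellTheta (A / (c₂ * c₃)) p *
        ellTheta (A * z ^ 2) p * ellTheta (c₁ * c₂ / A) p) := by
  have hA2 : c₁ * c₂ * c₃ * c₄ ≠ 0 := hc ▸ pow_ne_zero 2 hA
  simp only [mul_ne_zero_iff] at hA2
  obtain ⟨⟨⟨h1, h2⟩, h3⟩, h4⟩ := hA2
  obtain ⟨w, hw⟩ := exists_sq_eq_complex (c₁ * c₂)
  have hw0 : w ≠ 0 := by
    rintro rfl
    exact mul_ne_zero h1 h2 (by rw [← hw]; ring)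
  have hc2 : c₂ = w ^ 2 / c₁ := by rw [hw]; field_simp
  have hc4 : c₄ = A ^ 2 / (w ^ 2 * c₃) := by rw [hw, ← hc]; field_simp
  have := ellTheta_addition hp (x := z * w) (y := c₁ / w) (u := z * (A / w)) (v := c₃ * w / A)
    (by positivity) (by positivity) (by positivity) (by positivity)
  subst hc2 hc4
  rw [show c₁ * z = z * w * (c₁ / w) by field_simp,
    show w ^ 2 / c₁ * z = z * w / (c₁ / w) by field_simp,
    show c₃ * z = z * (A / w) * (c₃ * w / A) by field_simp,
    show A ^ 2 / (w ^ 2 * c₃) * z = z * (A / w) / (c₃ * w / A) by field_simp,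
    show A * z / c₁ = z * (A / w) / (c₁ / w) by field_simp,
    show A * z / (w ^ 2 / c₁) = z * (A / w) * (c₁ / w) by field_simp,
    show A * z / c₃ = z * w / (c₃ * w / A) by field_simp,
    show A * z / (A ^ 2 / (w ^ 2 * c₃)) = z * w * (c₃ * w / A) by field_simp,
    show c₁ * c₃ / A = c₁ / w * (c₃ * w / A) by field_simp,
    show A / (w ^ 2 / c₁ * c₃) = c₁ / w / (c₃ * w / A) by field_simp,
    show A * z ^ 2 = z * w * (z * (A / w)) by field_simp,
    show c₁ * (w ^ 2 / c₁) / A = z * w / (z * (A / w)) by field_simp]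
  linear_combination this

/-! ### Elliptic shifted factorials -/

theorem ellFactorial_zero (a q p : ℂ) : ellFactorial a q p 0 = 1 := Finset.prod_range_zero _

theorem ellFactorial_succ (a q p : ℂ) (n : ℕ) :
    ellFactorial a q p (n + 1) = ellFactorial a q p n * ellTheta (a * q ^ n) p :=
  Finset.prod_range_succ _ _

theorem ellFactorial_add (a q p : ℂ) (s n : ℕ) :
    ellFactorial a q p (s + n) = ellFactorial a q p s * ellFactorial (a * q ^ s) q p n := by
  simp only [ellFactorial, Finset.prod_range_add, pow_add, mul_assoc]

theorem ellFactorial_succ' (a q p : ℂ) (n : ℕ) :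
    ellFactorial a q p (n + 1) = ellTheta a p * ellFactorial (a * q) q p n := by
  rw [add_comm, ellFactorial_add, ellFactorial_succ, ellFactorial_zero]
  simp

theorem ellFactorial_two_mul (a q p : ℂ) (n : ℕ) :
    ellFactorial a q p (2 * n) = ellFactorial a (q ^ 2) p n * ellFactorial (a * q) (q ^ 2) p n := by
  induction n with
  | zero => simp [ellFactorial_zero]
  | succ n ih =>
    rw [show 2 * (n + 1) = 2 * n + 1 + 1 by ring, ellFactorial_succ, ellFactorial_succ, ih,
      ellFactorial_succ, ellFactorial_succ, show a * q ^ (2 * n + 1) = a * q * (q ^ 2) ^ n by ring,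
      pow_mul]
    ring

theorem ellFactorial_ne_zero {a q p : ℂ} (h : ∀ j : ℕ, ellTheta (a * q ^ j) p ≠ 0) (n : ℕ) :
    ellFactorial a q p n ≠ 0 :=
  Finset.prod_ne_zero_iff.mpr fun j _ => h j

/-! ### The Frenkel–Turaev summation -/

/-- The general term of the Frenkel–Turaev sum, without the very-well-poised factor. -/
noncomputable def ftWeight (a b c d k q p : ℂ) (n i : ℕ) : ℂ :=
  ellFactorial a q p i * ellFactorial b q p i * ellFactorial c q p i * ellFactorial d q p i /
    (ellFactorial q q p i * ellFactorial (a * q / b) q p i * ellFactorial (a * q / c) q p i *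
      ellFactorial (a * q / d) q p i) *
  (ellFactorial (k / a) q p (n - i) * ellFactorial k q p (n + i) /
    (ellFactorial q q p (n - i) * ellFactorial (a * q) q p (n + i))) *
  (k / a) ^ i / ellTheta a p

/-- The value of the Frenkel–Turaev sum. -/
noncomputable def ftValue (a b c d k q p : ℂ) (n : ℕ) : ℂ :=
  ellFactorial k q p n * ellFactorial (k * b / a) q p n * ellFactorial (k * c / a) q p n *
    ellFactorial (k * d / a) q p n /
    (ellFactorial q q p n * ellFactorial (a * q / b) q p n * ellFactorial (a * q / c) q p n *
      ellFactorial (a * q / d) q p n)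

section FrenkelTuraev

variable {a b c d k q p : ℂ}

/-- The balanced relation with `c = (1, a/(k q^(n+1)), a q^(n+1), k)`. The first product contains
`θ(q^i)` and the second `θ(q^i / q^(n+1))`, so one vanishes at `i = 0` and the other at `i = n + 1`.
-/
theorem ftWeight_split (hp : ‖p‖ < 1) (ha : a ≠ 0) (hk : k ≠ 0) (hq : q ≠ 0) (w : ℂ) (n i : ℕ) :
    w * ellTheta (a * q ^ (2 * i)) p * (ellTheta (q ^ (n + 1)) p * ellTheta (k / a) p *
      ellTheta (1 / (k * q ^ (n + 1))) p) =
    w / (a * q ^ i) * (ellTheta (q ^ i) p * ellTheta (a * q ^ i / (k * q ^ (n + 1))) p *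
      ellTheta (a * q ^ (n + 1 + i)) p * ellTheta (k * q ^ i) p) -
    w / (a * q ^ i) * (ellTheta (a * q ^ i) p * ellTheta (k * q ^ (n + 1 + i)) p *
      ellTheta (q ^ i / q ^ (n + 1)) p * ellTheta (a * q ^ i / k) p) := by
  have h := ellTheta_addition_balanced hp (z := q ^ i) (A := a) (c₁ := 1)
    (c₂ := a / (k * q ^ (n + 1))) (c₃ := a * q ^ (n + 1)) (c₄ := k) (by positivity) ha
    (by field_simp)
  rw [show 1 * q ^ i = q ^ i by ring,
    show a / (k * q ^ (n + 1)) * q ^ i = a * q ^ i / (k * q ^ (n + 1)) by ring,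
    show a * q ^ (n + 1) * q ^ i = a * q ^ (n + 1 + i) by ring,
    show a * q ^ i / 1 = a * q ^ i by ring,
    show a * q ^ i / (a / (k * q ^ (n + 1))) = k * q ^ (n + 1 + i) by field_simp; ring,
    show a * q ^ i / (a * q ^ (n + 1)) = q ^ i / q ^ (n + 1) by field_simp,
    show 1 * (a * q ^ (n + 1)) / a = q ^ (n + 1) by field_simp,
    show a / (a / (k * q ^ (n + 1)) * (a * q ^ (n + 1))) = k / a by field_simp,
    show a * (q ^ i) ^ 2 = a * q ^ (2 * i) by ring,
    show 1 * (a / (k * q ^ (n + 1))) / a = 1 / (k * q ^ (n + 1)) by field_simp] at h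
  rw [← mul_sub, h]
  field_simp

theorem ellFactorial_shift_div {x : ℂ} (h : ∀ j : ℕ, ellTheta (x * q ^ j) p ≠ 0) (n : ℕ) :
    ellFactorial x q p n = ellTheta x p * ellFactorial (x * q) q p n / ellTheta (x * q ^ n) p := by
  rw [eq_div_iff (h n), ← ellFactorial_succ, ellFactorial_succ']

/-- The second piece of the split at `i`, rewritten through the weight with parameters `(a * q, k *
q ^ 2)`. Writing the upper index as `i + l + 1` avoids truncated subtraction. -/
theorem ftWeight_lower (hp : ‖p‖ < 1) (ha : a ≠ 0) (hq : q ≠ 0)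
    (hqq : ∀ j : ℕ, ellTheta (q * q ^ j) p ≠ 0)
    (haq : ∀ j : ℕ, ellTheta (a * q ^ j) p ≠ 0)
    (hb : ∀ j : ℕ, ellTheta (a * q / b * q ^ j) p ≠ 0)
    (hc : ∀ j : ℕ, ellTheta (a * q / c * q ^ j) p ≠ 0)
    (hd : ∀ j : ℕ, ellTheta (a * q / d * q ^ j) p ≠ 0) (i l : ℕ) :
    -(ftWeight a b c d k q p (i + l + 1) i / (a * q ^ i) *
      (ellTheta (a * q ^ i) p * ellTheta (k * q ^ (i + l + 1 + i)) p *
      ellTheta (q ^ i / q ^ (i + l + 1)) p * ellTheta (a * q ^ i / k) p)) =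
    ellTheta k p * ellTheta (k * q) p * ellTheta (k / a) p / (a * q ^ (i + l + 1) *
      (ellTheta (a * q / b) p * ellTheta (a * q / c) p * ellTheta (a * q / d) p)) *
    (ftWeight (a * q) b c d (k * q ^ 2) q p (i + l) i / q ^ i) *
    (ellTheta (a * q * q ^ i / b) p * ellTheta (a * q * q ^ i / c) p *
      ellTheta (a * q * q ^ i / d) p * ellTheta (a * q ^ i / k) p) := by
  have haq' : ∀ j : ℕ, ellTheta (a * q * q ^ j) p ≠ 0 := fun j => by
    simpa [pow_succ', mul_assoc] using haq (j + 1)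
  have haq2 : ∀ j : ℕ, ellTheta (a * q * q * q ^ j) p ≠ 0 := fun j => by
    simpa [pow_succ', mul_assoc] using haq' (j + 1)
  have key : ∀ x : ℂ, (∀ j : ℕ, ellTheta (a * q / x * q ^ j) p ≠ 0) →
      ellFactorial (a * q / x) q p i = ellTheta (a * q / x) p *
        ellFactorial (a * q * q / x) q p i / ellTheta (a * q * q ^ i / x) p ∧
      ellFactorial (a * q * q / x) q p i ≠ 0 ∧ ellTheta (a * q * q ^ i / x) p ≠ 0 ∧
      ellTheta (a * q / x) p ≠ 0 := fun x hx => by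
    have e1 : a * q / x * q = a * q * q / x := by ring
    have e2 : a * q / x * q ^ i = a * q * q ^ i / x := by ring
    refine ⟨by rw [ellFactorial_shift_div hx, e1, e2], ?_, e2 ▸ hx i, by simpa using hx 0⟩
    rw [← e1]
    exact ellFactorial_ne_zero (fun j => by simpa [pow_succ', mul_assoc] using hx (j + 1)) i
  obtain ⟨b1, b2, b3, b4⟩ := key b hb
  obtain ⟨c1, c2, c3, c4⟩ := key c hc
  obtain ⟨d1, d2, d3, d4⟩ := key d hd
  have e1 : ellTheta (q ^ i / q ^ (i + l + 1)) p = -ellTheta (q * q ^ l) p / (q * q ^ l) := by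
    rw [← ellTheta_inv hp (by positivity)]
    congr 1
    rw [pow_succ, pow_add]
    field_simp
  have e2 : ellFactorial k q p (i + l + 1 + i) * ellTheta (k * q ^ (i + l + 1 + i)) p =
      ellTheta k p * ellTheta (k * q) p * ellFactorial (k * q ^ 2) q p (i + l + i) := by
    rw [← ellFactorial_succ, ellFactorial_succ', show i + l + 1 + i = i + l + i + 1 by ring,
      ellFactorial_succ', show k * q * q = k * q ^ 2 by ring, mul_assoc]
  have e3 : k * q ^ 2 / (a * q) = k / a * q := by field_simp
  have e4 := ellFactorial_shift_div haq i
  have n1 := ellFactorial_ne_zero hqq i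
  have n2 := ellFactorial_ne_zero hqq l
  have n3 := ellFactorial_ne_zero haq2 (i + l + i)
  have n4 := haq i
  have n5 : ellTheta a p ≠ 0 := by simpa using haq 0
  have n6 : ellTheta (a * q) p ≠ 0 := by simpa using haq 1
  have n7 := hqq l
  simp only [ftWeight]
  rw [show i + l + 1 - i = l + 1 by omega, show i + l - i = l by omega, b1, c1, d1, e1, e3, e4,
    ellFactorial_succ q, ellFactorial_succ' (k / a), show i + l + 1 + i = i + l + i + 1 by ring,
    ellFactorial_succ' (a * q)]
  rw [show i + l + 1 + i = i + l + i + 1 by ring] at e2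
  have e5 : q ^ (i + l + 1) = q ^ i * (q * q ^ l) := by ring
  rw [e5]
  have e6 : (k / a * q) ^ i = (k / a) ^ i * q ^ i := mul_pow _ _ _
  rw [e6]
  have m1 : q ^ i ≠ 0 := pow_ne_zero i hq
  have m2 : q ^ l ≠ 0 := pow_ne_zero l hq
  clear key hb hc hd haq hqq haq' haq2 b1 c1 d1 e1 e3 e4 e5 e6
  generalize ellTheta (k * q ^ (i + l + i + 1)) p = t1 at *
  generalize ellFactorial k q p (i + l + i + 1) = t2 at *
  generalize (k / a) ^ i = t3 at *
  generalize ellTheta (k / a) p = t4 at *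
  generalize ellFactorial (k * q ^ 2) q p (i + l + i) = t5 at *
  generalize ellTheta (a * q ^ i / k) p = t6 at *
  generalize ellFactorial (k / a * q) q p l = t7 at *
  generalize ellFactorial (a * q * q) q p (i + l + i) = t8 at *
  generalize ellFactorial (a * q * q / b) q p i = t9 at *
  generalize ellFactorial (a * q * q / c) q p i = t10 at *
  generalize ellFactorial (a * q * q / d) q p i = t11 at *
  generalize ellTheta (a * q * q ^ i / b) p = t12 at *
  generalize ellTheta (a * q * q ^ i / c) p = t13 at *
  generalize ellTheta (a * q * q ^ i / d) p = t14 at *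
  generalize ellTheta (a * q / b) p = t15 at *
  generalize ellTheta (a * q / c) p = t16 at *
  generalize ellTheta (a * q / d) p = t17 at *
  generalize ellFactorial (a * q) q p i = t18 at *
  generalize ellFactorial b q p i = t19 at *
  generalize ellFactorial c q p i = t20 at *
  generalize ellFactorial d q p i = t21 at *
  generalize ellFactorial q q p i = t22 at *
  generalize ellFactorial q q p l = t23 at *
  generalize ellTheta (a * q ^ i) p = t24 at *
  generalize ellTheta (a * q) p = t25 at *
  generalize ellTheta a p = t26 at *
  generalize ellTheta (q * q ^ l) p = t27 at *
  generalize ellTheta k p = t28 at *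
  generalize ellTheta (k * q) p = t29 at *
  generalize q ^ i = t30 at *
  generalize q ^ l = t31 at *
  field_simp
  linear_combination (t18 * t19 * t20 * t21 * t4 * t7 * t3 * t6) * e2

-- The first piece of the split at `i + 1`, expressed through the same constant and weight as in
-- `ftWeight_lower`, so that the two can be added.
set_option maxHeartbeats 1000000 in
theorem ftWeight_upper (hp : ‖p‖ < 1) (ha : a ≠ 0) (hk : k ≠ 0) (hq : q ≠ 0)
    (hqq : ∀ j : ℕ, ellTheta (q * q ^ j) p ≠ 0)
    (haq : ∀ j : ℕ, ellTheta (a * q ^ j) p ≠ 0)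
    (hb : ∀ j : ℕ, ellTheta (a * q / b * q ^ j) p ≠ 0)
    (hc : ∀ j : ℕ, ellTheta (a * q / c * q ^ j) p ≠ 0)
    (hd : ∀ j : ℕ, ellTheta (a * q / d * q ^ j) p ≠ 0) (i l : ℕ) :
    ftWeight a b c d k q p (i + l + 1) (i + 1) / (a * q ^ (i + 1)) *
      (ellTheta (q ^ (i + 1)) p * ellTheta (a * q ^ (i + 1) / (k * q ^ (i + l + 1))) p *
      ellTheta (a * q ^ (i + l + 1 + (i + 1))) p * ellTheta (k * q ^ (i + 1)) p) =
    -(ellTheta k p * ellTheta (k * q) p * ellTheta (k / a) p / (a * q ^ (i + l + 1) *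
      (ellTheta (a * q / b) p * ellTheta (a * q / c) p * ellTheta (a * q / d) p)) *
    (ftWeight (a * q) b c d (k * q ^ 2) q p (i + l) i / q ^ i) *
    (ellTheta (b * q ^ i) p * ellTheta (c * q ^ i) p *
      ellTheta (d * q ^ i) p * ellTheta (k * q ^ (i + 1)) p)) := by
  have haq' : ∀ j : ℕ, ellTheta (a * q * q ^ j) p ≠ 0 := fun j => by
    simpa [pow_succ', mul_assoc] using haq (j + 1)
  have haq2 : ∀ j : ℕ, ellTheta (a * q * q * q ^ j) p ≠ 0 := fun j => by
    simpa [pow_succ', mul_assoc] using haq' (j + 1)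
  have key : ∀ x : ℂ, (∀ j : ℕ, ellTheta (a * q / x * q ^ j) p ≠ 0) →
      ellFactorial (a * q / x) q p (i + 1) = ellTheta (a * q / x) p *
        ellFactorial (a * q * q / x) q p i ∧
      ellFactorial (a * q * q / x) q p i ≠ 0 ∧ ellTheta (a * q / x) p ≠ 0 := fun x hx => by
    have e1 : a * q / x * q = a * q * q / x := by ring
    refine ⟨by rw [ellFactorial_succ', e1], ?_, by simpa using hx 0⟩
    rw [← e1]
    exact ellFactorial_ne_zero (fun j => by simpa [pow_succ', mul_assoc] using hx (j + 1)) i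
  obtain ⟨b1, b2, b4⟩ := key b hb
  obtain ⟨c1, c2, c4⟩ := key c hc
  obtain ⟨d1, d2, d4⟩ := key d hd
  have e1 : ellTheta (a * q ^ (i + 1) / (k * q ^ (i + l + 1))) p =
      -ellTheta (k / a * q ^ l) p / (k / a * q ^ l) := by
    rw [← ellTheta_inv hp (by positivity)]
    congr 1
    rw [pow_succ q (i + l), pow_add q i l, pow_succ]
    field_simp
  have e2 : ellFactorial (k / a) q p l * ellTheta (k / a * q ^ l) p =
      ellTheta (k / a) p * ellFactorial (k / a * q) q p l := by
    rw [← ellFactorial_succ, ellFactorial_succ']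
  have e3 : k * q ^ 2 / (a * q) = k / a * q := by field_simp
  have e4 : ellFactorial k q p (i + l + i + 2) =
      ellTheta k p * ellTheta (k * q) p * ellFactorial (k * q ^ 2) q p (i + l + i) := by
    rw [ellFactorial_succ', ellFactorial_succ', show k * q * q = k * q ^ 2 by ring, mul_assoc]
  have e5 : ellFactorial (a * q) q p (i + l + i + 2) =
      ellTheta (a * q) p * ellFactorial (a * q * q) q p (i + l + i) *
        ellTheta (a * q * q ^ (i + l + i + 1)) p := by
    rw [ellFactorial_succ, ellFactorial_succ']
  have e6 : a * q ^ (i + l + i + 2) = a * q * q ^ (i + l + i + 1) := by ring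
  have e7 : q ^ (i + l + 1) = q ^ i * (q * q ^ l) := by ring
  have e8 : (k / a * q) ^ i = (k / a) ^ i * q ^ i := mul_pow _ _ _
  have n1 := ellFactorial_ne_zero hqq i
  have n2 := ellFactorial_ne_zero hqq l
  have n3 := ellFactorial_ne_zero haq2 (i + l + i)
  have n4 := haq' (i + l + i + 1)
  have n5 : ellTheta a p ≠ 0 := by simpa using haq 0
  have n6 : ellTheta (a * q) p ≠ 0 := by simpa using haq 1
  have n7 := hqq i
  have m1 : q ^ i ≠ 0 := pow_ne_zero i hq
  have m2 : q ^ l ≠ 0 := pow_ne_zero l hq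
  simp only [ftWeight]
  rw [show i + l + 1 - (i + 1) = l by omega, show i + l - i = l by omega,
    show i + l + 1 + (i + 1) = i + l + i + 2 by ring, b1, c1, d1, e1, e3, e4, e5, e6, e7, e8,
    ellFactorial_succ q, ellFactorial_succ' a, ellFactorial_succ b, ellFactorial_succ c,
    ellFactorial_succ d, pow_succ (k / a), pow_succ' q i]
  clear key hb hc hd haq hqq haq' haq2 b1 c1 d1 e1 e3 e4 e5 e6 e7 e8
  generalize ellTheta (k * (q * q ^ i)) p = t1 at *
  generalize ellFactorial (k / a) q p l = t2 at *
  generalize (k / a) ^ i = t3 at *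
  generalize ellTheta (k / a) p = t4 at *
  generalize ellFactorial (k * q ^ 2) q p (i + l + i) = t5 at *
  generalize ellTheta (k / a * q ^ l) p = t6 at *
  generalize ellFactorial (k / a * q) q p l = t7 at *
  generalize ellFactorial (a * q * q) q p (i + l + i) = t8 at *
  generalize ellFactorial (a * q * q / b) q p i = t9 at *
  generalize ellFactorial (a * q * q / c) q p i = t10 at *
  generalize ellFactorial (a * q * q / d) q p i = t11 at *
  generalize ellTheta (b * q ^ i) p = t12 at *
  generalize ellTheta (c * q ^ i) p = t13 at *
  generalize ellTheta (d * q ^ i) p = t14 at *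
  generalize ellTheta (a * q / b) p = t15 at *
  generalize ellTheta (a * q / c) p = t16 at *
  generalize ellTheta (a * q / d) p = t17 at *
  generalize ellFactorial (a * q) q p i = t18 at *
  generalize ellFactorial b q p i = t19 at *
  generalize ellFactorial c q p i = t20 at *
  generalize ellFactorial d q p i = t21 at *
  generalize ellFactorial q q p i = t22 at *
  generalize ellFactorial q q p l = t23 at *
  generalize ellTheta (a * q * q ^ (i + l + i + 1)) p = t24 at *
  generalize ellTheta (a * q) p = t25 at *
  generalize ellTheta a p = t26 at *
  generalize ellTheta (q * q ^ i) p = t27 at *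
  generalize ellTheta k p = t28 at *
  generalize ellTheta (k * q) p = t29 at *
  generalize q ^ i = t30 at *
  generalize q ^ l = t31 at *
  field_simp
  linear_combination -(t18 * t19 * t12 * t20 * t13 * t21 * t14 * t28 * t29 * t5 * t3 * t1) * e2

/-- The balanced relation again, with `A = a * q` and `c = (b, c, d, k * q)`; it restores the
very-well-poised factor of the shifted series. -/
theorem ftWeight_merge (hp : ‖p‖ < 1) (ha : a ≠ 0) (hq : q ≠ 0) (hbcd : b * c * d * k = a ^ 2 * q)
    (i : ℕ) :
    ellTheta (a * q * q ^ i / b) p * ellTheta (a * q * q ^ i / c) p *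
      ellTheta (a * q * q ^ i / d) p * ellTheta (a * q ^ i / k) p -
    ellTheta (b * q ^ i) p * ellTheta (c * q ^ i) p *
      ellTheta (d * q ^ i) p * ellTheta (k * q ^ (i + 1)) p =
    -(a * q ^ (i + 1) / b * (ellTheta (a / (k * c)) p * ellTheta (k * b / a) p *
      ellTheta (a * q * q ^ (2 * i)) p * ellTheta (a / (k * d)) p)) := by
  have hne : b * c * d * k ≠ 0 := hbcd ▸ mul_ne_zero (pow_ne_zero 2 ha) hq
  simp only [mul_ne_zero_iff] at hne
  obtain ⟨⟨⟨hb, hc⟩, hd⟩, hk⟩ := hne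
  have h := ellTheta_addition_balanced hp (z := q ^ i) (A := a * q) (c₁ := b)
    (c₂ := c) (c₃ := d) (c₄ := k * q) (by positivity) (by positivity)
    (by linear_combination q * hbcd)
  rw [show k * q * q ^ i = k * q ^ (i + 1) by ring,
    show a * q * q ^ i / (k * q) = a * q ^ i / k by field_simp,
    show b * d / (a * q) = a / (k * c) by field_simp; linear_combination hbcd,
    show a * q / (c * d) = k * b / a by field_simp; linear_combination -hbcd,
    show a * q * (q ^ i) ^ 2 = a * q * q ^ (2 * i) by ring,
    show b * c / (a * q) = a / (k * d) by field_simp; linear_combination hbcd] at h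
  rw [show a * q ^ (i + 1) = a * q * q ^ i by ring]
  linear_combination -h

theorem sum_ftWeight_succ (hp : ‖p‖ < 1) (ha : a ≠ 0) (hq : q ≠ 0)
    (hbcd : b * c * d * k = a ^ 2 * q)
    (hqq : ∀ j : ℕ, ellTheta (q * q ^ j) p ≠ 0)
    (haq : ∀ j : ℕ, ellTheta (a * q ^ j) p ≠ 0)
    (hb : ∀ j : ℕ, ellTheta (a * q / b * q ^ j) p ≠ 0)
    (hc : ∀ j : ℕ, ellTheta (a * q / c * q ^ j) p ≠ 0)
    (hd : ∀ j : ℕ, ellTheta (a * q / d * q ^ j) p ≠ 0) (n : ℕ) :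
    (∑ i ∈ Finset.range (n + 1 + 1),
      ftWeight a b c d k q p (n + 1) i * ellTheta (a * q ^ (2 * i)) p) *
      (ellTheta (q ^ (n + 1)) p * ellTheta (k / a) p * ellTheta (1 / (k * q ^ (n + 1))) p) =
    -(ellTheta k p * ellTheta (k * q) p * ellTheta (k / a) p / (a * q ^ (n + 1) *
      (ellTheta (a * q / b) p * ellTheta (a * q / c) p * ellTheta (a * q / d) p)) *
      (a * q / b * (ellTheta (a / (k * c)) p * ellTheta (k * b / a) p *
        ellTheta (a / (k * d)) p))) *
    ∑ i ∈ Finset.range (n + 1),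
      ftWeight (a * q) b c d (k * q ^ 2) q p n i * ellTheta (a * q * q ^ (2 * i)) p := by
  have hk : k ≠ 0 := by
    rintro rfl
    exact mul_ne_zero (pow_ne_zero 2 ha) hq (by rw [← hbcd, mul_zero])
  rw [Finset.sum_mul, Finset.sum_congr rfl fun i _ =>
    -- Both boundary terms vanish because `θ(1) = 0`.
    ftWeight_split hp ha hk hq (ftWeight a b c d k q p (n + 1) i) n i, Finset.sum_sub_distrib,
    Finset.sum_range_succ', Finset.sum_range_succ _ (n + 1), div_self (pow_ne_zero (n + 1) hq),
    pow_zero, ellTheta_one]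
  simp only [zero_mul, mul_zero, add_zero]
  rw [← Finset.sum_sub_distrib, Finset.mul_sum]
  refine Finset.sum_congr rfl fun i hi => ?_
  obtain ⟨l, rfl⟩ := Nat.exists_eq_add_of_le (Nat.lt_succ_iff.mp (Finset.mem_range.mp hi))
  have h1 := ftWeight_lower (k := k) hp ha hq hqq haq hb hc hd i l
  have h2 := ftWeight_upper hp ha hk hq hqq haq hb hc hd i l
  have h3 := ftWeight_merge hp ha hq hbcd i
  rw [h2, sub_eq_add_neg, h1]
  generalize ellTheta k p * ellTheta (k * q) p * ellTheta (k / a) p / (a * q ^ (i + l + 1) *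
      (ellTheta (a * q / b) p * ellTheta (a * q / c) p * ellTheta (a * q / d) p)) = κ
  have h4 : a * q ^ (i + 1) / b = a * q / b * q ^ i := by ring
  rw [h4] at h3
  have m1 : q ^ i ≠ 0 := pow_ne_zero i hq
  generalize ftWeight (a * q) b c d (k * q ^ 2) q p (i + l) i = w
  have h5 : w / q ^ i * q ^ i = w := div_mul_cancel₀ _ m1
  generalize w / q ^ i = v at *
  rw [← h5]
  linear_combination (κ * v) * h3

/-- The closed form obeys the recurrence of `sum_ftWeight_succ` with the same factor; the balancing
condition enters through `e3`. -/
theorem ftValue_succ (hp : ‖p‖ < 1) (ha : a ≠ 0) (hq : q ≠ 0)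
    (hbcd : b * c * d * k = a ^ 2 * q)
    (hqq : ∀ j : ℕ, ellTheta (q * q ^ j) p ≠ 0)
    (hb : ∀ j : ℕ, ellTheta (a * q / b * q ^ j) p ≠ 0)
    (hc : ∀ j : ℕ, ellTheta (a * q / c * q ^ j) p ≠ 0)
    (hd : ∀ j : ℕ, ellTheta (a * q / d * q ^ j) p ≠ 0) (n : ℕ) :
    ftValue a b c d k q p (n + 1) *
      (ellTheta (q ^ (n + 1)) p * ellTheta (k / a) p * ellTheta (1 / (k * q ^ (n + 1))) p) =
    -(ellTheta k p * ellTheta (k * q) p * ellTheta (k / a) p / (a * q ^ (n + 1) *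
      (ellTheta (a * q / b) p * ellTheta (a * q / c) p * ellTheta (a * q / d) p)) *
      (a * q / b * (ellTheta (a / (k * c)) p * ellTheta (k * b / a) p *
        ellTheta (a / (k * d)) p))) *
    ftValue (a * q) b c d (k * q ^ 2) q p n := by
  have hne : b * c * d * k ≠ 0 := hbcd ▸ mul_ne_zero (pow_ne_zero 2 ha) hq
  simp only [mul_ne_zero_iff] at hne
  obtain ⟨⟨⟨hb0, hc0⟩, hd0⟩, hk⟩ := hne
  have key : ∀ x : ℂ, (∀ j : ℕ, ellTheta (a * q / x * q ^ j) p ≠ 0) →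
      ellFactorial (a * q / x) q p (n + 1) = ellTheta (a * q / x) p *
        ellFactorial (a * q * q / x) q p n ∧
      ellFactorial (a * q * q / x) q p n ≠ 0 ∧ ellTheta (a * q / x) p ≠ 0 := fun x hx => by
    have e1 : a * q / x * q = a * q * q / x := by ring
    refine ⟨by rw [ellFactorial_succ', e1], ?_, by simpa using hx 0⟩
    rw [← e1]
    exact ellFactorial_ne_zero (fun j => by simpa [pow_succ', mul_assoc] using hx (j + 1)) n
  obtain ⟨b1, b2, b4⟩ := key b hb
  obtain ⟨c1, c2, c4⟩ := key c hc
  obtain ⟨d1, d2, d4⟩ := key d hd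
  have num : ∀ x : ℂ, ellFactorial (k * x / a) q p (n + 1) = ellTheta (k * x / a) p *
      ellFactorial (k * q ^ 2 * x / (a * q)) q p n := fun x => by
    rw [ellFactorial_succ', show k * x / a * q = k * q ^ 2 * x / (a * q) by field_simp]
  have flip : ∀ x : ℂ, x ≠ 0 → ellTheta (a / (k * x)) p =
      -ellTheta (k * x / a) p / (k * x / a) := fun x hx => by
    rw [← ellTheta_inv hp (by positivity), inv_div]
  have e1 : ellTheta (1 / (k * q ^ (n + 1))) p =
      -ellTheta (k * q ^ (n + 1)) p / (k * q ^ (n + 1)) := by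
    rw [← ellTheta_inv hp (by positivity), one_div]
  have e2 : ellFactorial k q p (n + 1) * ellTheta (k * q ^ (n + 1)) p =
      ellTheta k p * ellTheta (k * q) p * ellFactorial (k * q ^ 2) q p n := by
    rw [← ellFactorial_succ, ellFactorial_succ', ellFactorial_succ',
      show k * q * q = k * q ^ 2 by ring, mul_assoc]
  have n1 := ellFactorial_ne_zero hqq n
  have n2 := hqq n
  have hb1 : b = a ^ 2 * q / (c * d * k) := by rw [← hbcd]; field_simp
  have e3 : a * q / b * ((k * c / a)⁻¹ * (k * d / a)⁻¹) = a / k := by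
    rw [hb1]; field_simp
  rw [ftValue, ftValue, num, num, num, b1, c1, d1, flip c hc0, flip d hd0, e1,
    ellFactorial_succ q, show q ^ (n + 1) = q * q ^ n by ring]
  rw [show q ^ (n + 1) = q * q ^ n by ring] at e2
  have m1 : q ^ n ≠ 0 := pow_ne_zero n hq
  clear key hb hc hd hqq b1 c1 d1 num flip e1 hbcd hb1
  simp only [div_eq_mul_inv (-ellTheta _ p)]
  generalize (k * c / a)⁻¹ = s1 at *
  generalize (k * d / a)⁻¹ = s2 at *
  generalize a * q / b = s3 at *
  generalize ellFactorial (k * q ^ 2) q p n = t1 at *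
  generalize ellFactorial (k * q ^ 2 * b / (a * q)) q p n = t2 at *
  generalize ellFactorial (k * q ^ 2 * c / (a * q)) q p n = t3 at *
  generalize ellFactorial (k * q ^ 2 * d / (a * q)) q p n = t4 at *
  generalize ellFactorial (a * q * q / b) q p n = t5 at *
  generalize ellFactorial (a * q * q / c) q p n = t6 at *
  generalize ellFactorial (a * q * q / d) q p n = t7 at *
  generalize ellTheta s3 p = t8 at *
  generalize ellTheta (a * q / c) p = t9 at *
  generalize ellTheta (a * q / d) p = t10 at *
  generalize ellTheta (k * b / a) p = t11 at *
  generalize ellTheta (k * c / a) p = t12 at *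
  generalize ellTheta (k * d / a) p = t13 at *
  generalize ellTheta (k / a) p = t14 at *
  generalize ellTheta (k * (q * q ^ n)) p = t15 at *
  generalize ellFactorial k q p (n + 1) = t16 at *
  generalize ellFactorial q q p n = t17 at *
  generalize ellTheta (q * q ^ n) p = t18 at *
  generalize ellTheta k p = t19 at *
  generalize ellTheta (k * q) p = t20 at *
  generalize q ^ n = t21 at *
  have e4 : k * (s3 * (s1 * s2)) = a := by rw [e3]; field_simp
  field_simp
  linear_combination -(t11 * t2 * t12 * t3 * t13 * t4 * t14 * a) * e2 +
    (t11 * t2 * t12 * t3 * t13 * t4 * t14 * (t19 * t20 * t1)) * e4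

theorem frenkelTuraev_of_generic (hp : ‖p‖ < 1) (hq : q ≠ 0)
    (hqq : ∀ j : ℕ, ellTheta (q * q ^ j) p ≠ 0) (n : ℕ) (ha : a ≠ 0)
    (hbcd : b * c * d * k = a ^ 2 * q)
    (haq : ∀ j : ℕ, ellTheta (a * q ^ j) p ≠ 0)
    (hb : ∀ j : ℕ, ellTheta (a * q / b * q ^ j) p ≠ 0)
    (hc : ∀ j : ℕ, ellTheta (a * q / c * q ^ j) p ≠ 0)
    (hd : ∀ j : ℕ, ellTheta (a * q / d * q ^ j) p ≠ 0)
    (hk : ∀ j : ℕ, ellTheta (k * q ^ j) p ≠ 0) (hka : ∀ j : ℕ, ellTheta (k / a * q ^ j) p ≠ 0) :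
    ∑ i ∈ Finset.range (n + 1), ftWeight a b c d k q p n i * ellTheta (a * q ^ (2 * i)) p =
      ftValue a b c d k q p n := by
  induction n generalizing a k with
  | zero =>
    have : ellTheta a p ≠ 0 := by simpa using haq 0
    simp [ftWeight, ftValue, ellFactorial_zero, this]
  | succ n ih =>
    have hk0 : k ≠ 0 := by
      rintro rfl
      exact mul_ne_zero (pow_ne_zero 2 ha) hq (by rw [← hbcd, mul_zero])
    have h := ih (a := a * q) (k := k * q ^ 2) (mul_ne_zero ha hq)
      (by linear_combination q ^ 2 * hbcd)
      (fun j => by simpa [pow_succ', mul_assoc] using haq (j + 1))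
      (fun j => by convert hb (j + 1) using 2; ring)
      (fun j => by convert hc (j + 1) using 2; ring)
      (fun j => by convert hd (j + 1) using 2; ring)
      (fun j => by convert hk (j + 2) using 2; ring)
      (fun j => by convert hka (j + 1) using 2; field_simp; ring)
    -- The recurrence determines the sum only after cancelling this factor; this is where the
    -- conditions on `k` and `k / a` enter.
    have hne : ellTheta (q ^ (n + 1)) p * ellTheta (k / a) p *
        ellTheta (1 / (k * q ^ (n + 1))) p ≠ 0 := by
      refine mul_ne_zero (mul_ne_zero ?_ (by simpa using hka 0)) ?_
      · rw [pow_succ']; exact hqq n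
      · rw [one_div, ellTheta_inv hp (by positivity)]
        exact div_ne_zero (neg_ne_zero.mpr (hk (n + 1))) (by positivity)
    refine mul_right_cancel₀ hne ?_
    rw [sum_ftWeight_succ hp ha hq hbcd hqq haq hb hc hd, h,
      ftValue_succ hp ha hq hbcd hqq hb hc hd]

/-! ### Removing the genericity conditions on `k` by continuity -/

theorem countable_ellTheta_mul_eq_zero (hp : ‖p‖ < 1) {x : ℂ} (hx : x ≠ 0) :
    {t : ℂ | t ≠ 0 ∧ ellTheta (t * x) p = 0}.Countable := by
  refine (Set.countable_range fun j : ℤ => p ^ j / x).mono ?_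
  rintro t ⟨ht, h⟩
  obtain ⟨j, hj⟩ := exists_zpow_of_ellTheta_eq_zero hp (mul_ne_zero ht hx) h
  exact ⟨j, by simp only [← hj]; field_simp⟩

theorem continuousAt_ellTheta_comp (hp : ‖p‖ < 1) {f : ℂ → ℂ} {t : ℂ} (hf : ContinuousAt f t)
    (h0 : f t ≠ 0) : ContinuousAt (fun s => ellTheta (f s) p) t :=
  ContinuousAt.comp (f := f) (continuousAt_ellTheta hp h0) hf

theorem continuousAt_ellFactorial_comp (hp : ‖p‖ < 1) (hq : q ≠ 0) {f : ℂ → ℂ} {t : ℂ}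
    (hf : ContinuousAt f t) (h0 : f t ≠ 0) (n : ℕ) :
    ContinuousAt (fun s => ellFactorial (f s) q p n) t := by
  simp only [ellFactorial]
  exact tendsto_finsetProd _ fun j _ => continuousAt_ellTheta_comp hp (hf.mul continuousAt_const)
    (mul_ne_zero h0 (pow_ne_zero j hq))

/-- The Frenkel–Turaev summation formula. -/
theorem frenkelTuraev (hp : ‖p‖ < 1) (hq : q ≠ 0)
    (hqq : ∀ j : ℕ, ellTheta (q * q ^ j) p ≠ 0) (n : ℕ) (ha : a ≠ 0)
    (hbcd : b * c * d * k = a ^ 2 * q)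
    (haq : ∀ j : ℕ, ellTheta (a * q ^ j) p ≠ 0)
    (hb : ∀ j : ℕ, ellTheta (a * q / b * q ^ j) p ≠ 0)
    (hc : ∀ j : ℕ, ellTheta (a * q / c * q ^ j) p ≠ 0)
    (hd : ∀ j : ℕ, ellTheta (a * q / d * q ^ j) p ≠ 0) :
    ∑ i ∈ Finset.range (n + 1), ftWeight a b c d k q p n i * ellTheta (a * q ^ (2 * i)) p =
      ftValue a b c d k q p n := by
  have hne : b * c * d * k ≠ 0 := hbcd ▸ mul_ne_zero (pow_ne_zero 2 ha) hq
  simp only [mul_ne_zero_iff] at hne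
  obtain ⟨⟨⟨hb0, hc0⟩, hd0⟩, hk0⟩ := hne
  -- The deformation `k ↦ k * t`, `d ↦ d / t` preserves the balancing condition. The generic values
  -- of `t` have countable complement, and both sides are continuous at `t = 1`.
  set S : Set ℂ := {t | t ≠ 0 ∧ (∀ j : ℕ, ellTheta (t * (k * q ^ j)) p ≠ 0) ∧
    (∀ j : ℕ, ellTheta (t * (k / a * q ^ j)) p ≠ 0) ∧
    (∀ j : ℕ, ellTheta (t * (a * q / d * q ^ j)) p ≠ 0)}
  have hdense : Dense S := by
    have hcount : ({0} ∪ ((⋃ j : ℕ, {t : ℂ | t ≠ 0 ∧ ellTheta (t * (k * q ^ j)) p = 0}) ∪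
        ((⋃ j : ℕ, {t : ℂ | t ≠ 0 ∧ ellTheta (t * (k / a * q ^ j)) p = 0}) ∪
        (⋃ j : ℕ, {t : ℂ | t ≠ 0 ∧ ellTheta (t * (a * q / d * q ^ j)) p = 0}))) :
        Set ℂ).Countable :=
      (Set.countable_singleton 0).union
        ((Set.countable_iUnion fun j => countable_ellTheta_mul_eq_zero hp (by positivity)).union
        ((Set.countable_iUnion fun j => countable_ellTheta_mul_eq_zero hp (by positivity)).union
        (Set.countable_iUnion fun j => countable_ellTheta_mul_eq_zero hp (by positivity))))
    refine (hcount.dense_compl ℂ).mono fun t ht => ?_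
    simp only [Set.mem_compl_iff, Set.mem_union, Set.mem_singleton_iff, Set.mem_iUnion,
      Set.mem_ofPred_eq, not_or, not_exists, not_and] at ht
    exact ⟨ht.1, fun j => ht.2.1 j ht.1, fun j => ht.2.2.1 j ht.1, fun j => ht.2.2.2 j ht.1⟩
  have heq : ∀ t ∈ S, ∑ i ∈ Finset.range (n + 1),
      ftWeight a b c (d / t) (k * t) q p n i * ellTheta (a * q ^ (2 * i)) p =
      ftValue a b c (d / t) (k * t) q p n := by
    rintro t ⟨ht0, ht1, ht2, ht3⟩
    refine frenkelTuraev_of_generic hp hq hqq n ha ?_ haq hb hc (fun j => ?_) (fun j => ?_)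
      (fun j => ?_)
    · rw [← hbcd]; field_simp
    · convert ht3 j using 2; field_simp
    · convert ht1 j using 2; ring
    · convert ht2 j using 2; ring
  have hd1 : ContinuousAt (fun t : ℂ => d / t) 1 := continuousAt_const.div continuousAt_id one_ne_zero
  have hk1 : ContinuousAt (fun t : ℂ => k * t) 1 := continuousAt_const.mul continuousAt_id
  have had1 : ContinuousAt (fun t : ℂ => a * q / (d / t)) 1 :=
    continuousAt_const.div hd1 (by simpa using hd0)
  have hka1 : ContinuousAt (fun t : ℂ => k * t / a) 1 := hk1.div_const a
  have nb := ellFactorial_ne_zero hb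
  have nc := ellFactorial_ne_zero hc
  have nd := ellFactorial_ne_zero hd
  have nq := ellFactorial_ne_zero hqq
  have cF : ∀ {f : ℂ → ℂ}, ContinuousAt f 1 → f 1 ≠ 0 → ∀ n,
      ContinuousAt (fun s => ellFactorial (f s) q p n) 1 :=
    fun hf h0 n => continuousAt_ellFactorial_comp hp hq hf h0 n
  have cd := cF hd1 (by simpa using hd0)
  have cad := cF had1 (by simp [*])
  have ck := cF hk1 (by simpa using hk0)
  have cka := cF hka1 (by simp [*])
  have ckx : ∀ x : ℂ, x ≠ 0 → ∀ n,
      ContinuousAt (fun s => ellFactorial (k * s * x / a) q p n) 1 := fun x hx =>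
    cF ((hk1.mul continuousAt_const).div_const a) (by simp [*])
  have ckd : ∀ n, ContinuousAt (fun s => ellFactorial (k * s * (d / s) / a) q p n) 1 :=
    cF ((hk1.mul hd1).div_const a) (by simp [*])
  have hL : ContinuousAt (fun t => ∑ i ∈ Finset.range (n + 1),
      ftWeight a b c (d / t) (k * t) q p n i * ellTheta (a * q ^ (2 * i)) p) 1 := by
    refine tendsto_finsetSum _ fun i _ => ?_
    simp only [ftWeight]
    refine ContinuousAt.mul (ContinuousAt.div_const (ContinuousAt.mul (ContinuousAt.mul
      (ContinuousAt.div (continuousAt_const.mul (cd i)) (continuousAt_const.mul (cad i)) ?_)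
      (((cka _).mul (ck _)).div_const _)) (hka1.pow i)) _) continuousAt_const
    simp only [Pi.mul_apply, div_one]
    exact mul_ne_zero (mul_ne_zero (mul_ne_zero (nq i) (nb i)) (nc i)) (nd i)
  have hR : ContinuousAt (fun t => ftValue a b c (d / t) (k * t) q p n) 1 := by
    simp only [ftValue]
    refine ContinuousAt.div ((((ck n).mul (ckx b hb0 n)).mul (ckx c hc0 n)).mul (ckd n))
      (continuousAt_const.mul (cad n)) ?_
    rw [div_one]
    exact mul_ne_zero (mul_ne_zero (mul_ne_zero (nq n) (nb n)) (nc n)) (nd n)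
  have hmem : (1 : ℂ) ∈ closure S := hdense 1
  rw [mem_closure_iff_nhdsWithin_neBot] at hmem
  have hL' := hL.tendsto.mono_left (nhdsWithin_le_nhds (s := S))
  have hR' := hR.tendsto.mono_left (nhdsWithin_le_nhds (s := S))
  have := tendsto_nhds_unique (hL'.congr' (by
    filter_upwards [self_mem_nhdsWithin] with t ht using heq t ht)) hR'
  simpa using this

end FrenkelTuraev

/-! ### A quadratic summation -/

/-- The general term of the quadratic sum. -/
noncomputable def quadTerm (a m k q p : ℂ) (n j : ℕ) : ℂ :=
  ellTheta (m * q ^ (2 * j)) p / ellTheta m p *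
    (ellFactorial (k / m) (q ^ 2) p ((n - j) / 2) /
      ellFactorial (q ^ 2) (q ^ 2) p ((n - j) / 2)) *
    (ellFactorial k (q ^ 2) p ((n + j) / 2) / ellFactorial (m * q ^ 2) (q ^ 2) p ((n + j) / 2)) *
    (-(a / m)) ^ j *
    (ellFactorial (m / a) q p j / ellFactorial q q p j *
      (ellFactorial m q p j / ellFactorial (a * q) q p j))

section Quadratic

variable {a m k q p : ℂ}

theorem sum_quadTerm_even (hp : ‖p‖ < 1) (ha : a ≠ 0) (hk : k ≠ 0) (hq : q ≠ 0)
    (hm : k * m = a ^ 2)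
    (hqq : ∀ j : ℕ, ellTheta (q * q ^ j) p ≠ 0)
    (haq : ∀ j : ℕ, ellTheta (a * q * q ^ j) p ≠ 0)
    (hmq : ∀ j : ℕ, ellTheta (m * (q ^ 2) ^ j) p ≠ 0) (n : ℕ) :
    ∑ i ∈ Finset.range (n + 1), quadTerm a m k q p (2 * n) (2 * i) =
      ellFactorial (k / a) q p (2 * n) / ellFactorial q q p (2 * n) *
        (ellFactorial k q p (2 * n) / ellFactorial (a * q) q p (2 * n)) := by
  have hm0 : m ≠ 0 := by
    rintro rfl
    exact pow_ne_zero 2 ha (by rw [← hm, mul_zero])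
  have e1 : m * q ^ 2 / (m / a) = a * q * q := by field_simp
  have e2 : m * q ^ 2 / (m * q / a) = a * q := by field_simp
  have e3 : m * q ^ 2 / (m * q) = q := by field_simp
  have f1 : k * (m / a) / m = k / a := by field_simp
  have f2 : k * (m * q / a) / m = k / a * q := by field_simp
  have f3 : k * (m * q) / m = k * q := by field_simp
  -- The parameters come from splitting `(m/a;q)_{2i}` and `(m;q)_{2i}` in base `q ^ 2`; the factor
  -- `(m;q²)_i` is the leading one.
  have h := frenkelTuraev (a := m) (b := m / a) (c := m * q / a) (d := m * q) (k := k)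
    (q := q ^ 2) hp (pow_ne_zero 2 hq)
    (fun j => by convert hqq (2 * j + 1) using 2; ring) n hm0
    (by field_simp; linear_combination hm) hmq
    (fun j => by rw [e1]; convert haq (2 * j + 1) using 2; ring)
    (fun j => by rw [e2]; convert haq (2 * j) using 2; ring)
    (fun j => by rw [e3]; convert hqq (2 * j) using 2; ring)
  rw [ftValue, e1, e2, e3, f1, f2, f3] at h
  rw [ellFactorial_two_mul, ellFactorial_two_mul, ellFactorial_two_mul, ellFactorial_two_mul,
    ← pow_two q]
  refine Eq.trans (Finset.sum_congr rfl fun i hi => ?_) (h.trans (by ring))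
  have e4 : (-(a / m)) ^ (2 * i) = (k / m) ^ i := by
    rw [pow_mul]
    congr 1
    field_simp
    linear_combination -hm
  rw [quadTerm, ftWeight, e1, e2, e3, show (2 * n - 2 * i) / 2 = n - i by omega,
    show (2 * n + 2 * i) / 2 = n + i by omega, e4, ellFactorial_two_mul, ellFactorial_two_mul,
    ellFactorial_two_mul, ellFactorial_two_mul, ← pow_two q,
    show m / a * q = m * q / a by ring, show m * (q ^ 2) ^ (2 * i) = m * q ^ (2 * (2 * i)) by ring]
  ring

theorem sum_quadTerm_odd (hp : ‖p‖ < 1) (ha : a ≠ 0) (hk : k ≠ 0) (hq : q ≠ 0)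
    (hm : k * m = a ^ 2)
    (hqq : ∀ j : ℕ, ellTheta (q * q ^ j) p ≠ 0)
    (haq : ∀ j : ℕ, ellTheta (a * q * q ^ j) p ≠ 0)
    (hmq : ∀ j : ℕ, ellTheta (m * (q ^ 2) ^ j) p ≠ 0) (n : ℕ) :
    ∑ i ∈ Finset.range (n + 1), quadTerm a m k q p (2 * n + 1) (2 * i + 1) =
      ellFactorial (k / a) q p (2 * n + 1) / ellFactorial q q p (2 * n + 1) *
        (ellFactorial k q p (2 * n + 1) / ellFactorial (a * q) q p (2 * n + 1)) := by
  have hm0 : m ≠ 0 := by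
    rintro rfl
    exact pow_ne_zero 2 ha (by rw [← hm, mul_zero])
  have e1 : m * q ^ 2 * q ^ 2 / (m * q / a) = a * q * q * q := by field_simp
  have e2 : m * q ^ 2 * q ^ 2 / (m * q ^ 2 / a) = a * q * q := by field_simp
  have e3 : m * q ^ 2 * q ^ 2 / (m * q) = q * q * q := by field_simp
  have f0 : k * q ^ 2 / (m * q ^ 2) = k / m := by field_simp
  have f1 : k * q ^ 2 * (m * q / a) / (m * q ^ 2) = k / a * q := by field_simp
  have f2 : k * q ^ 2 * (m * q ^ 2 / a) / (m * q ^ 2) = k / a * q * q := by field_simp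
  have f3 : k * q ^ 2 * (m * q) / (m * q ^ 2) = k * q := by field_simp
  have h := frenkelTuraev (a := m * q ^ 2) (b := m * q / a) (c := m * q ^ 2 / a) (d := m * q)
    (k := k * q ^ 2) (q := q ^ 2) hp (pow_ne_zero 2 hq)
    (fun j => by convert hqq (2 * j + 1) using 2; ring) n (by positivity)
    (by field_simp; linear_combination hm)
    (fun j => by convert hmq (j + 1) using 2; ring)
    (fun j => by rw [e1]; convert haq (2 * j + 2) using 2; ring)
    (fun j => by rw [e2]; convert haq (2 * j + 1) using 2; ring)
    (fun j => by rw [e3]; convert hqq (2 * j + 2) using 2; ring)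
  rw [ftValue, e1, e2, e3, f1, f2, f3] at h
  -- Since `k / a = (m / a)⁻¹`, inversion accounts for the extra odd power of `-(a / m)`.
  have hθ : ellTheta (k / a) p = -(a / m) * ellTheta (m / a) p := by
    have : k / a = (m / a)⁻¹ := by field_simp; linear_combination hm
    rw [this, ellTheta_inv hp (by positivity)]
    field_simp
  have hθm : ellTheta m p ≠ 0 := by simpa using hmq 0
  rw [ellFactorial_succ', ellFactorial_succ', ellFactorial_succ', ellFactorial_succ',
    ellFactorial_two_mul, ellFactorial_two_mul, ellFactorial_two_mul, ellFactorial_two_mul, hθ]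
  -- The Frenkel–Turaev sum times the theta functions split off from the odd-length factorials.
  have h' : (∑ i ∈ Finset.range (n + 1), ftWeight (m * q ^ 2) (m * q / a) (m * q ^ 2 / a) (m * q)
      (k * q ^ 2) (q ^ 2) p n i * ellTheta (m * q ^ 2 * (q ^ 2) ^ (2 * i)) p) *
      (ellTheta k p * (-(a / m) * ellTheta (m / a) p) / (ellTheta q p * ellTheta (a * q) p)) =
      -(a / m) * ellTheta (m / a) p *
        (ellFactorial (k / a * q) (q ^ 2) p n * ellFactorial (k / a * q * q) (q ^ 2) p n) /
        (ellTheta q p *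
          (ellFactorial (q * q) (q ^ 2) p n * ellFactorial (q * q * q) (q ^ 2) p n)) *
      (ellTheta k p *
          (ellFactorial (k * q) (q ^ 2) p n * ellFactorial (k * q * q) (q ^ 2) p n) /
        (ellTheta (a * q) p *
          (ellFactorial (a * q * q) (q ^ 2) p n * ellFactorial (a * q * q * q) (q ^ 2) p n))) := by
    rw [h, show k * q * q = k * q ^ 2 by ring, ← pow_two q]
    ring
  refine Eq.trans ?_ h'
  rw [Finset.sum_mul]
  refine Finset.sum_congr rfl fun i hi => ?_
  have e4 : (-(a / m)) ^ (2 * i) = (k / m) ^ i := by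
    rw [pow_mul]
    congr 1
    field_simp
    linear_combination -hm
  rw [quadTerm, ftWeight, e1, e2, e3, f0, show (2 * n + 1 - (2 * i + 1)) / 2 = n - i by omega,
    show (2 * n + 1 + (2 * i + 1)) / 2 = n + i + 1 by omega,
    pow_succ (-(a / m)), e4,
    ellFactorial_succ' (m / a), ellFactorial_succ' q, ellFactorial_succ' m,
    ellFactorial_succ' (a * q), ellFactorial_succ' k, ellFactorial_succ' (m * q ^ 2),
    ellFactorial_two_mul, ellFactorial_two_mul, ellFactorial_two_mul, ellFactorial_two_mul,
    show m / a * q = m * q / a by ring, show m * q / a * q = m * q ^ 2 / a by ring,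
    show m * q * q = m * q ^ 2 by ring, ← pow_two q,
    show m * q ^ 2 * (q ^ 2) ^ (2 * i) = m * q ^ (2 * (2 * i + 1)) by ring]
  have cancel : ∀ x y : ℂ, x = (ellTheta m p)⁻¹ * ellTheta m p * y → x = y := fun x y hxy => by
    rwa [inv_mul_cancel₀ hθm, one_mul] at hxy
  apply cancel
  ring

end Quadratic

/-! ### Change of parameters in an elliptic WP Bailey pair -/

section Change

variable {a k m q p : ℂ}

theorem sum_filter_modEq_two (f : ℕ → ℂ) {s e v : ℕ} (he : e < 2) :
    ∑ r ∈ (Finset.range (s + (2 * v + e) + 1)).filter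
      (fun r => r ≡ s + (2 * v + e) [MOD 2] ∧ s ≤ r), f r =
    ∑ i ∈ Finset.range (v + 1), f (s + (2 * i + e)) := by
  symm
  refine Finset.sum_nbij' (fun i => s + (2 * i + e)) (fun r => (r - s) / 2) ?_ ?_ ?_ ?_ ?_
  · intro i hi
    rw [Finset.mem_range] at hi
    rw [Finset.mem_filter, Finset.mem_range, Nat.ModEq]
    omega
  · intro r hr
    rw [Finset.mem_filter, Finset.mem_range, Nat.ModEq] at hr
    rw [Finset.mem_range]
    omega
  · intro i hi
    omega
  · intro r hr
    rw [Finset.mem_filter, Finset.mem_range, Nat.ModEq] at hr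
    omega
  · intro i hi
    rfl

theorem sum_quadTerm (hp : ‖p‖ < 1) (ha : a ≠ 0) (hk : k ≠ 0) (hq : q ≠ 0)
    (hm : k * m = a ^ 2)
    (hqq : ∀ j : ℕ, ellTheta (q * q ^ j) p ≠ 0)
    (haq : ∀ j : ℕ, ellTheta (a * q * q ^ j) p ≠ 0)
    (hmq : ∀ j : ℕ, ellTheta (m * (q ^ 2) ^ j) p ≠ 0) {v e : ℕ} (he : e < 2) :
    ∑ i ∈ Finset.range (v + 1), quadTerm a m k q p (2 * v + e) (2 * i + e) =
      ellFactorial (k / a) q p (2 * v + e) / ellFactorial q q p (2 * v + e) *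
        (ellFactorial k q p (2 * v + e) / ellFactorial (a * q) q p (2 * v + e)) := by
  interval_cases e
  · exact sum_quadTerm_even hp ha hk hq hm hqq haq hmq v
  · exact sum_quadTerm_odd hp ha hk hq hm hqq haq hmq v

/-- The summand for the index `r = s + j` is a multiple of the general term of a quadratic sum with
parameters shifted by `s`. -/
theorem changeTerm_eq (hq : q ≠ 0) (hmq : ∀ j : ℕ, ellTheta (m * (q ^ 2) ^ j) p ≠ 0)
    (s n j : ℕ) :
    (ellTheta (m * q ^ (2 * (s + j))) p / ellTheta m p) *
      (ellFactorial (k / m) (q ^ 2) p ((s + n - (s + j)) / 2) /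
        ellFactorial (q ^ 2) (q ^ 2) p ((s + n - (s + j)) / 2)) *
      (ellFactorial k (q ^ 2) p ((s + n + (s + j)) / 2) /
        ellFactorial (m * q ^ 2) (q ^ 2) p ((s + n + (s + j)) / 2)) *
      (-(a / m)) ^ (s + j) *
      ((ellFactorial (m / a) q p (s + j - s) / ellFactorial q q p (s + j - s)) *
      (ellFactorial m q p (s + j + s) / ellFactorial (a * q) q p (s + j + s))) =
    ellFactorial k (q ^ 2) p s * ellFactorial (m * q) (q ^ 2) p s /
      ellFactorial (a * q) q p (2 * s) * (-(a / m)) ^ s *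
      quadTerm (a * q ^ (2 * s)) (m * q ^ (2 * s)) (k * q ^ (2 * s)) q p n j := by
  have hM : ellTheta (m * q ^ (2 * s)) p ≠ 0 := by rw [pow_mul]; exact hmq s
  have hm0 : ellTheta m p ≠ 0 := by simpa using hmq 0
  have hmQ : ellFactorial (m * q ^ 2) (q ^ 2) p s ≠ 0 :=
    ellFactorial_ne_zero (fun j => by simpa [pow_succ', mul_assoc] using hmq (j + 1)) s
  have hqs : q ^ (2 * s) ≠ 0 := pow_ne_zero _ hq
  -- This trades `θ(m)` for `θ(m q^(2s))`, the normalisation of the shifted sum, and cancels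
  -- `(mq²;q²)_s`.
  have e1 : ellFactorial m (q ^ 2) p s * ellTheta (m * q ^ (2 * s)) p =
      ellTheta m p * ellFactorial (m * q ^ 2) (q ^ 2) p s := by
    rw [pow_mul, ← ellFactorial_succ, ellFactorial_succ']
  rw [quadTerm, show s + n - (s + j) = n - j by omega, show s + j - s = j by omega,
    show (s + n + (s + j)) / 2 = s + (n + j) / 2 by omega, show s + j + s = 2 * s + j by ring,
    ellFactorial_add k, ellFactorial_add (m * q ^ 2), ellFactorial_add m,
    ellFactorial_add (a * q), ellFactorial_two_mul m, pow_add (-(a / m)),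
    mul_div_mul_right _ _ hqs, mul_div_mul_right _ _ hqs, mul_div_mul_right _ _ hqs,
    show m * q ^ 2 * (q ^ 2) ^ s = m * q ^ (2 * s) * q ^ 2 by rw [pow_mul]; ring,
    show k * (q ^ 2) ^ s = k * q ^ (2 * s) by rw [pow_mul],
    show a * q * q ^ (2 * s) = a * q ^ (2 * s) * q by ring,
    show m * q ^ (2 * (s + j)) = m * q ^ (2 * s) * q ^ (2 * j) by ring]
  have e2 : ellFactorial m (q ^ 2) p s =
      ellTheta m p * ellFactorial (m * q ^ 2) (q ^ 2) p s / ellTheta (m * q ^ (2 * s)) p :=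
    eq_div_of_mul_eq hM e1
  rw [e2]
  have cancel : ∀ x y : ℂ, x = (ellTheta m p)⁻¹ * ellTheta m p *
      ((ellFactorial (m * q ^ 2) (q ^ 2) p s)⁻¹ * ellFactorial (m * q ^ 2) (q ^ 2) p s) * y →
      x = y := fun x y hxy => by
    rwa [inv_mul_cancel₀ hm0, inv_mul_cancel₀ hmQ, one_mul, one_mul] at hxy
  apply cancel
  ring

/-- The coefficient of `α s` after interchanging the sums. The `(k;q²)_s` in the prefactor is
`(k;q)_{2s} / (kq;q²)_s`, which supplies both the kernel's `(k;q)_{n+s}` and the denominator of the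
new `α`. -/
theorem sum_changeTerm (hp : ‖p‖ < 1) (ha : a ≠ 0) (hk : k ≠ 0) (hq : q ≠ 0)
    (hm : k * m = a ^ 2)
    (hqq : ∀ j : ℕ, ellTheta (q * q ^ j) p ≠ 0)
    (haq : ∀ j : ℕ, ellTheta (a * q * q ^ j) p ≠ 0)
    (hkq : ∀ j : ℕ, ellTheta (k * q * (q ^ 2) ^ j) p ≠ 0)
    (hmq : ∀ j : ℕ, ellTheta (m * (q ^ 2) ^ j) p ≠ 0) {s n : ℕ} (hs : s ≤ n) :
    ∑ r ∈ (Finset.range (n + 1)).filter (fun r => r ≡ n [MOD 2] ∧ s ≤ r),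
      (ellTheta (m * q ^ (2 * r)) p / ellTheta m p) *
      (ellFactorial (k / m) (q ^ 2) p ((n - r) / 2) /
        ellFactorial (q ^ 2) (q ^ 2) p ((n - r) / 2)) *
      (ellFactorial k (q ^ 2) p ((n + r) / 2) /
        ellFactorial (m * q ^ 2) (q ^ 2) p ((n + r) / 2)) *
      (-(a / m)) ^ r *
      ((ellFactorial (m / a) q p (r - s) / ellFactorial q q p (r - s)) *
      (ellFactorial m q p (r + s) / ellFactorial (a * q) q p (r + s))) =
    (ellFactorial (k / a) q p (n - s) / ellFactorial q q p (n - s)) *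
      (ellFactorial k q p (n + s) / ellFactorial (a * q) q p (n + s)) *
      (ellFactorial (m * q) (q ^ 2) p s / ellFactorial (k * q) (q ^ 2) p s * (-(a / m)) ^ s) := by
  obtain ⟨v, e, he, rfl⟩ : ∃ v e, e < 2 ∧ n = s + (2 * v + e) :=
    ⟨(n - s) / 2, (n - s) % 2, Nat.mod_lt _ two_pos, by omega⟩
  have hqs : q ^ (2 * s) ≠ 0 := pow_ne_zero _ hq
  rw [sum_filter_modEq_two _ he, Finset.sum_congr rfl fun i _ => changeTerm_eq hq hmq s _ _,
    ← Finset.mul_sum, sum_quadTerm hp (mul_ne_zero ha hqs) (mul_ne_zero hk hqs) hq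
    (by linear_combination (q ^ (2 * s)) ^ 2 * hm) hqq
    (fun j => by convert haq (2 * s + j) using 2; ring)
    (fun j => by convert hmq (s + j) using 2; ring) he, mul_div_mul_right _ _ hqs,
    show s + (2 * v + e) - s = 2 * v + e by omega,
    show s + (2 * v + e) + s = 2 * s + (2 * v + e) by ring, ellFactorial_add k,
    ellFactorial_add (a * q), ellFactorial_two_mul k,
    show a * q * q ^ (2 * s) = a * q ^ (2 * s) * q by ring]
  have hkQ : ellFactorial (k * q) (q ^ 2) p s ≠ 0 := ellFactorial_ne_zero hkq s
  have cancel : ∀ x y : ℂ, (ellFactorial (k * q) (q ^ 2) p s)⁻¹ *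
      ellFactorial (k * q) (q ^ 2) p s * x = y → x = y := fun x y hxy => by
    rwa [inv_mul_cancel₀ hkQ, one_mul] at hxy
  apply cancel
  ring

end Change

/-! ### Interchange of summations and conclusion -/

theorem theorem5p1 (a k m q p : ℂ)
    (ha : a ≠ 0) (hk : k ≠ 0) (hq : q ≠ 0) (hp : ‖p‖ < 1)
    (hm : m = a ^ 2 / k)
    -- genericity: no theta function in a denominator vanishes
    (hqq : ∀ j : ℕ, ellTheta (q * q ^ j) p ≠ 0)
    (haq : ∀ j : ℕ, ellTheta (a * q * q ^ j) p ≠ 0)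
    (hkq : ∀ j : ℕ, ellTheta (k * q * (q ^ 2) ^ j) p ≠ 0)
    (hmq : ∀ j : ℕ, ellTheta (m * (q ^ 2) ^ j) p ≠ 0)
    (α β : ℕ → ℂ)
    (h : IsEllipticWPBaileyPair a m q p α β) :
    IsEllipticWPBaileyPair a k q p
      (fun n =>
        ellFactorial (m * q) (q ^ 2) p n / ellFactorial (k * q) (q ^ 2) p n *
          (-(a / m)) ^ n * α n)
      (fun n =>
        ∑ r ∈ (Finset.range (n + 1)).filter (fun r => r ≡ n [MOD 2]),
          (ellTheta (m * q ^ (2 * r)) p / ellTheta m p) *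
            (ellFactorial (k / m) (q ^ 2) p ((n - r) / 2) /
              ellFactorial (q ^ 2) (q ^ 2) p ((n - r) / 2)) *
            (ellFactorial k (q ^ 2) p ((n + r) / 2) /
              ellFactorial (m * q ^ 2) (q ^ 2) p ((n + r) / 2)) *
            (-(a / m)) ^ r * β r) := by
  have hm' : k * m = a ^ 2 := by rw [hm]; field_simp
  intro n
  simp only
  rw [Finset.sum_congr rfl fun r _ => by rw [h r, Finset.mul_sum]]
  -- The triangle `s ≤ r ≤ n` is reordered: `s` runs freely up to `n`, and `s ≤ r` joins the parity
  -- condition on `r`.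
  rw [Finset.sum_comm' (t' := Finset.range (n + 1))
    (s' := fun s => (Finset.range (n + 1)).filter (fun r => r ≡ n [MOD 2] ∧ s ≤ r))]
  · refine Finset.sum_congr rfl fun s hs => ?_
    have key := sum_changeTerm hp ha hk hq hm' hqq haq hkq hmq
      (Nat.lt_succ_iff.mp (Finset.mem_range.mp hs))
    rw [← mul_assoc, ← key, Finset.sum_mul]
    exact Finset.sum_congr rfl fun r _ => by ring
  · intro r s
    simp only [Finset.mem_filter, Finset.mem_range, Nat.lt_succ_iff]
    exact ⟨fun h => ⟨⟨h.1.1, h.1.2, h.2⟩, h.2.trans h.1.1⟩, fun h => ⟨⟨h.1.1, h.1.2.1⟩, h.1.2.2⟩⟩
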